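/- **Setting.** Let $m\ge 2$ agents be the vertices of a connected undirected graph $\mathcal G$. Agent $i$ holds a differentiable function $f_i:\mathbb R^d\to\mathbb R$ that is $\mu$-strongly convex and $L$-smooth, $\mu>0$, i.e. for all $x,y$ $$f_i(x)+\langle\nabla f_i(x),y-x\rangle+\tfrac{\mu}{2}\|y-x\|^2\le f_i(y)\le f_i(x)+\langle\nabla f_i(x),y-x\rangle+\tfrac{L}{2}\|y-x\|^2 .$$ Let $B\in\mathbb R^{p\times d}$ with $B\neq0$ and $\ker B\ne\{0\}$, and let $W\in\mathbb R^{m\times m}$ be symmetric positive semidefinite with $W_{ij}=0$ whenever $i\ne j$ are not adjacent and $\ker W=\mathrm{span}\{\mathbf 1\}$. Put $\mathbf W=W\otimes I_d$, $\mathbf B=I_m\otimes B$, $F(\mathbf x)=\sum_i f_i(x_i)$ for $\mathbf x=\mathrm{col}(x_1,\dots,x_m)$, and consider $$\min_{\mathbf x\in\mathbb R^{md}}F(\mathbf x)\quad\text{s.t. }\mathbf W\mathbf x=0,\ \mathbf B\mathbf x=0 .$$ For symmetric positive semidefinite $M\neq0$ let $\lambda_{\max}(M)$ and $\lambda^+_{\min}(M)$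 be its largest and smallest nonzero eigenvalues and $\chi(M)=\lambda_{\max}(M)/\lambda_{\min}^+(M)$. For $\gamma>0$ let $\mathbf A=\binom{\mathbf B}{\gamma\mathbf W}$, let $F^*(\mathbf q)=\sup_{\mathbf x}(\langle\mathbf q,\mathbf x\rangle-F(\mathbf x))$, $\Phi(\mathbf y)=\sup_{\mathbf x}\{-F(\mathbf x)+\langle\mathbf y,\mathbf A\mathbf x\rangle\}$ and $\mathbf x(\mathbf q)=\nabla F^*(\mathbf q)$. Let $\gamma_*=\sqrt{\lambda^+_{\min}(B^\top B)}/\lambda^+_{\min}(W)$. *Methods.* For symmetric positive semidefinite $\mathbf H\in\mathbb R^{md\times md}$ put $\eta=\mu/\lambda_{\max}(\mathbf H)$ and $\beta=\frac{\sqrt{\lambda_{\max}(\mathbf H)/\mu}-\sqrt{\lambda_{\min}^+(\mathbf H)/L}}{\sqrt{\lambda_{\max}(\mathbf H)/\mu}+\sqrt{\lambda_{\min}^+(\mathbf H)/L}}$. The fast dual method is $\mathbf y^{-1}=\mathbf y^0$, $\mathbf z=\mathbf y^k+\beta(\mathbf y^k-\mathbf y^{k-1})$, $\mathbf y^{k+1}=\mathbf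 z-\eta\nabla\Phi(\mathbf z)$, with $\mathbf H=\mathbf A^\top\mathbf A$. The globally dual method with matrix $\mathbf H$ is $\mathbf p^{-1}=\mathbf p^0$, $\mathbf q=\mathbf p^k+\beta(\mathbf p^k-\mathbf p^{k-1})$, $\mathbf p^{k+1}=\mathbf q-\eta\mathbf H\,\mathbf x(\mathbf q)$. *Chebyshev acceleration.* With $a=\lambda^+_{\min}(M)$, $b=\lambda_{\max}(M)$, $K=\lceil\sqrt{\chi(M)}\rceil$ and $T_K$ the Chebyshev polynomial, let $P_M(t)=1-T_K\!\big(\tfrac{b+a-2t}{b-a}\big)/T_K\!\big(\tfrac{b+a}{b-a}\big)$ if $a<b$, and $P_M(t)=t/b$ if $a=b$; put $\widehat M=P_M(M)$. The accelerated method is the globally dual method with $\widehat{\mathbf H}=I_m\otimes\widehat{B^\top B}+\widehat\gamma^2\,\widehat W^2\otimes I_d$, $\widehat\gamma^2=\lambda^+_{\min}(\widehat{B^\top B})/\lambda^+_{\min}(\widehat W)^2$. *Cost.* Every node stores vectors of $\mathbb R^d$ and $\mathbb R^p$, initially only its own blocks of the starting point, and forms linear combinations of stored vectors for free. One oracle call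 lets each node $i$ evaluate $\nabla f_i^*$ at one stored vector; one communication lets each node send one stored vector to all its neighbours; one multiplication lets each node multiply one stored vector by $B$ or $B^\top$. *Accuracy.* $\mathbf x$ is an $\varepsilon$-solution if $F(\mathbf x)-F(\mathbf x')\le\varepsilon$ for every feasible $\mathbf x'$, and $\|\mathbf A\mathbf x\|\le\varepsilon$. For a solution $\mathbf x^*$ and a start $\mathbf p^0$ let $r=\|\mathbf p^0-\nabla F(\mathbf x^*)\|/\mu$ and $$D_\gamma(\mathbf p^0)=3+\sqrt{\lambda_{\max}(\mathbf A^\top\mathbf A)}\,r+\|\nabla F(\mathbf x^*)\|\,r+L r^2 .$$ **Claim.** There is a universal constant $C>0$ such that for every such problem a solution $\mathbf x^*$ exists and the following hold. 1. $\mathbf x(\mathbf q)$ is the unique maximizer of $\langle\mathbf q,\mathbf x\rangle-F(\mathbf x)$. For every $\gamma>0$ the supremum defining $\Phi$ is attained, $\Phi(\mathbf y)=F^*(\mathbf A^\top\mathbf y)$, $\nabla\Phi(\mathbf y)=\mathbf A\,\mathbf x(\mathbf A^\top\mathbf y)$, and $\Phi$ is $\frac{\lambda_{\max}(\mathbf A^\top\mathbf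 A)}{\mu}$-smooth on the whole space and $\frac{\lambda_{\min}^+(\mathbf A^\top\mathbf A)}{L}$-strongly convex on $(\ker\mathbf A^\top)^\perp$. 2. For every $\gamma>0$, $\mathbf y^0$, $\varepsilon\in(0,1)$ and every $k\ge C\sqrt{L/\mu}\,\sqrt{\chi(\mathbf A^\top\mathbf A)}\,\log(D_\gamma(\mathbf A^\top\mathbf y^0)/\varepsilon)$, the fast dual method satisfies $\Phi(\mathbf y^k)-\inf\Phi\le\varepsilon$. Moreover $\eta>0$, $\beta\in(0,1)$, and $\mathbf p^k=\mathbf A^\top\mathbf y^k$ are the iterates of the globally dual method with $\mathbf H=\mathbf A^\top\mathbf A$ started at $\mathbf A^\top\mathbf y^0$. 3. For every $\gamma>0$, $\chi(\mathbf A^\top\mathbf A)=\dfrac{\lambda_{\max}(B^\top B)+\gamma^2\lambda_{\max}(W)^2}{\min\{\lambda_{\min}^+(B^\top B),\gamma^2\lambda_{\min}^+(W)^2\}}$; over $\gamma>0$ it is minimal at $\gamma_*>0$, with value $\chi(B^\top B)+\chi(W)^2$. From now on $\gamma=\gamma_*$ and $0<\varepsilon<1$. 4. For every $\mathbf y^0$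 there is $N$ such that $\mathbf x(\mathbf A^\top\mathbf y^k)$ is an $\varepsilon$-solution for all $k\ge N$, and $\mathbf x(\mathbf A^\top\mathbf y^N)$ can be computed so that $N$ and the numbers of oracle calls, of communications and of multiplications by $B,B^\top$ are each at most $$C\sqrt{\tfrac L\mu}\,\sqrt{\chi(B^\top B)+\chi(W)^2}\,\log\frac{D_\gamma(\mathbf A^\top\mathbf y^0)}{\varepsilon}.$$ 5. For $M\in\{W,B^\top B\}$ we have $\deg P_M\le C\sqrt{\chi(M)}$ and $\chi(\widehat M)\le C$. The accelerated method has $\eta>0$ and $\beta\in(0,1)$, and for every $\mathbf p^0\in\mathrm{range}\,\mathbf A^\top$ there is $N$ such that $\mathbf x(\mathbf p^k)$ is an $\varepsilon$-solution for all $k\ge N$, and $\mathbf x(\mathbf p^N)$ can be computed with $N_{\rm or}$ oracle calls at each node, at most $C N_{\rm or}\sqrt{\chi(W)}$ communications and at most $C N_{\rm or}\sqrt{\chi(B^\top B)}$ multiplications by $B,B^\top$ at each node, where $$\max\{N,N_{\rm or}\}\le C\sqrt{\tfrac L\mu}\,\log\frac{D_\gamma(\mathbf p^0)}{\varepsilon}.$$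 -/

import Mathlib

open scoped Kronecker Gradient RealInnerProductSpace

noncomputable section

namespace GloballyDual

/-- Column vectors with the Euclidean norm. -/
abbrev Vec (ι : Type) : Type := EuclideanSpace ℝ ι

/-! ### Spectral quantities of a symmetric positive semidefinite matrix -/

section Spectral

variable {n : Type} [Fintype n] [DecidableEq n]

/-- The maximal eigenvalue. -/
def lamMax (M : Matrix n n ℝ) : ℝ := sSup (spectrum ℝ M)

/-- The minimal nonzero eigenvalue. -/
def lamMinPos (M : Matrix n n ℝ) : ℝ := sInf {l | l ∈ spectrum ℝ M ∧ l ≠ 0}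

/-- The condition number `χ`. -/
def chi (M : Matrix n n ℝ) : ℝ := lamMax M / lamMinPos M

end Spectral

/-! ### Convex analysis -/

section Convex

variable {E : Type} [NormedAddCommGroup E] [InnerProductSpace ℝ E] [CompleteSpace E]

def IsSmooth (L : ℝ) (f : E → ℝ) : Prop :=
  Differentiable ℝ f ∧ ∀ x y : E, f y ≤ f x + ⟪∇ f x, y - x⟫ + L / 2 * ‖y - x‖ ^ 2

def IsStronglyConvexOn (s : Set E) (μ : ℝ) (f : E → ℝ) : Prop :=
  Differentiable ℝ f ∧
    ∀ x ∈ s, ∀ y ∈ s, f x + ⟪∇ f x, y - x⟫ + μ / 2 * ‖y - x‖ ^ 2 ≤ f y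

/-- The convex conjugate `f*(q) = sup_x (⟨q, x⟩ - f x)`. -/
def conjugate (f : E → ℝ) (q : E) : ℝ := ⨆ x : E, (⟪q, x⟫ - f x)

/-- The dual oracle `∇f*(q)`. -/
def dualOracle (f : E → ℝ) (q : E) : E := ∇ (conjugate f) q

/-- Nesterov's method with constant step `η` and constant momentum `β` for the gradient map `g`.
The `k`-th value is the pair `(y^k, y^{k-1})`, with `y^{-1} = y^0`. -/
def accel (g : E → E) (η β : ℝ) (y₀ : E) : ℕ → E × E
  | 0 => (y₀, y₀)
  | k + 1 =>
    let s := accel g η β y₀ k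
    let z := s.1 + β • (s.1 - s.2)
    (z - η • g z, s.1)

end Convex

/-! ### The decentralized problem with affine constraints -/

/-- The data: `m` agents with local objectives on `ℝ^d`, a graph, a gossip matrix `W`, a `p × d`
constraint matrix `B`, and the strong convexity and smoothness constants. -/
structure Problem (m d p : ℕ) where
  graph : SimpleGraph (Fin m)
  W : Matrix (Fin m) (Fin m) ℝ
  B : Matrix (Fin p) (Fin d) ℝ
  f : Fin m → Vec (Fin d) → ℝ
  μ : ℝ
  L : ℝ

structure Problem.Assumptions {m d p : ℕ} (P : Problem m d p) : Prop where
  two_le : 2 ≤ m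
  connected : P.graph.Connected
  posSemidef : P.W.PosSemidef
  compatible : ∀ i j, i ≠ j → ¬ P.graph.Adj i j → P.W i j = 0
  kernel : ∀ v : Fin m → ℝ, P.W.mulVec v = 0 ↔ ∀ i j, v i = v j
  B_ne_zero : P.B ≠ 0
  ker_B : ∃ x : Fin d → ℝ, x ≠ 0 ∧ P.B.mulVec x = 0
  μ_pos : 0 < P.μ
  smooth : ∀ i, IsSmooth P.L (P.f i)
  strong : ∀ i, IsStronglyConvexOn Set.univ P.μ (P.f i)

/-- The `i`-th block `x_i` of `x = col(x_1, …, x_m)`. -/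
def block {m n : ℕ} (x : Vec (Fin m × Fin n)) (i : Fin m) : Vec (Fin n) :=
  WithLp.toLp 2 fun j => x (i, j)

namespace Problem

variable {m d p : ℕ} (P : Problem m d p)

def F (x : Vec (Fin m × Fin d)) : ℝ := ∑ i, P.f i (block x i)

/-- `W ⊗ I_d`. -/
def bigW : Matrix (Fin m × Fin d) (Fin m × Fin d) ℝ :=
  P.W ⊗ₖ (1 : Matrix (Fin d) (Fin d) ℝ)

/-- `I_m ⊗ B`. -/
def bigB : Matrix (Fin m × Fin p) (Fin m × Fin d) ℝ :=
  (1 : Matrix (Fin m) (Fin m) ℝ) ⊗ₖ P.B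

def Feasible (x : Vec (Fin m × Fin d)) : Prop :=
  P.bigW.toEuclideanLin x = 0 ∧ P.bigB.toEuclideanLin x = 0

def IsSolution (x : Vec (Fin m × Fin d)) : Prop :=
  P.Feasible x ∧ ∀ z, P.Feasible z → P.F x ≤ P.F z

/-- The index type of the dual variable `y = (u, v)`, `u ∈ ℝ^{mp}`, `v ∈ ℝ^{md}`. -/
abbrev DualIdx (m d p : ℕ) : Type := (Fin m × Fin p) ⊕ (Fin m × Fin d)

/-- The matrix `A` with row blocks `I ⊗ B` and `γ (W ⊗ I)`. -/
def A (γ : ℝ) : Matrix (DualIdx m d p) (Fin m × Fin d) ℝ :=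
  Matrix.fromRows P.bigB (γ • P.bigW)

/-- `Aᵀ A`. -/
def gram (γ : ℝ) : Matrix (Fin m × Fin d) (Fin m × Fin d) ℝ :=
  (P.A γ).transpose * P.A γ

/-- `Bᵀ B`. -/
def BtB : Matrix (Fin d) (Fin d) ℝ := P.B.transpose * P.B

/-- The weight `γ` with `γ² = λ⁺_min(BᵀB) / λ⁺_min(W)²`. -/
def gammaOpt : ℝ := √(lamMinPos P.BtB) / lamMinPos P.W

/-- The dual function `Φ(y) = max_x (-F(x) + ⟨y, A x⟩)`. -/
def Phi (γ : ℝ) (y : Vec (DualIdx m d p)) : ℝ :=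
  ⨆ x : Vec (Fin m × Fin d), (-P.F x + ⟪y, (P.A γ).toEuclideanLin x⟫)

/-- The smoothness constant `λ_max(H)/μ` of `y ↦ F*(H^{1/2} y)`. -/
def dualL (H : Matrix (Fin m × Fin d) (Fin m × Fin d) ℝ) : ℝ := lamMax H / P.μ

/-- The strong convexity constant `λ⁺_min(H)/L` of `y ↦ F*(H^{1/2} y)` on `(ker H)^⊥`. -/
def dualMu (H : Matrix (Fin m × Fin d) (Fin m × Fin d) ℝ) : ℝ := lamMinPos H / P.L

def step (H : Matrix (Fin m × Fin d) (Fin m × Fin d) ℝ) : ℝ := 1 / P.dualL H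

def momentum (H : Matrix (Fin m × Fin d) (Fin m × Fin d) ℝ) : ℝ :=
  (√(P.dualL H) - √(P.dualMu H)) / (√(P.dualL H) + √(P.dualMu H))

/-- The iterates `y^k` of Nesterov's fast gradient method applied to `Φ`. -/
def fastDual (γ : ℝ) (y₀ : Vec (DualIdx m d p)) (k : ℕ) : Vec (DualIdx m d p) :=
  (accel (∇ (P.Phi γ)) (P.step (P.gram γ)) (P.momentum (P.gram γ)) y₀ k).1

/-- The iterates `p^k` of the globally dual method
`q = p^k + β (p^k - p^{k-1})`, `p^{k+1} = q - η H x(q)`, where `x(q) = ∇F*(q)`. -/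
def globallyDual (H : Matrix (Fin m × Fin d) (Fin m × Fin d) ℝ)
    (p₀ : Vec (Fin m × Fin d)) (k : ℕ) : Vec (Fin m × Fin d) :=
  (accel (fun q => H.toEuclideanLin (dualOracle P.F q)) (P.step H) (P.momentum H) p₀ k).1

/-- `x` is `ε`-optimal and `ε`-feasible. -/
def EpsSolution (γ ε : ℝ) (x : Vec (Fin m × Fin d)) : Prop :=
  (∀ z, P.Feasible z → P.F x - P.F z ≤ ε) ∧ ‖(P.A γ).toEuclideanLin x‖ ≤ ε

/-- The problem-dependent factor `D` in the logarithm `log(D / ε)`, for the starting point `p₀`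
and the solution `xs`; it does not depend on `ε`. -/
def scale (γ : ℝ) (p₀ xs : Vec (Fin m × Fin d)) : ℝ :=
  let r := ‖p₀ - ∇ P.F xs‖ / P.μ
  3 + √(lamMax (P.gram γ)) * r + ‖∇ P.F xs‖ * r + P.L * r ^ 2

end Problem

/-! ### Chebyshev acceleration -/

/-- The rescaled Chebyshev polynomial of degree `K` for a spectrum in `{0} ∪ [lo, hi]`:
`1 - T_K((hi + lo - 2 X) / (hi - lo)) / T_K((hi + lo) / (hi - lo))`, and `X / hi` if `lo = hi`. -/
def chebPoly (lo hi : ℝ) (K : ℕ) : Polynomial ℝ :=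
  if lo = hi then Polynomial.C (1 / hi) * Polynomial.X
  else
    1 - Polynomial.C (1 / (Polynomial.Chebyshev.T ℝ (K : ℤ)).eval ((hi + lo) / (hi - lo))) *
      (Polynomial.Chebyshev.T ℝ (K : ℤ)).comp
        (Polynomial.C ((hi + lo) / (hi - lo)) - Polynomial.C (2 / (hi - lo)) * Polynomial.X)

/-- The Chebyshev polynomial used for the matrix `M`, of degree `⌈√χ(M)⌉`. -/
def chebFor {n : Type} [Fintype n] [DecidableEq n] (M : Matrix n n ℝ) : Polynomial ℝ :=
  chebPoly (lamMinPos M) (lamMax M) ⌈√(chi M)⌉₊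

/-- `P_K(M)`. -/
def chebMat {n : Type} [Fintype n] [DecidableEq n] (M : Matrix n n ℝ) : Matrix n n ℝ :=
  Polynomial.aeval M (chebFor M)

/-- `Aᵀ A = I ⊗ BᵀB + γ² W² ⊗ I` with `BᵀB` replaced by `P_M(BᵀB)`, `W` by `P_K(W)`, and `γ`
chosen by the same rule for the new matrices. -/
def Problem.chebGram {m d p : ℕ} (P : Problem m d p) :
    Matrix (Fin m × Fin d) (Fin m × Fin d) ℝ :=
  (1 : Matrix (Fin m) (Fin m) ℝ) ⊗ₖ chebMat P.BtB +
    (lamMinPos (chebMat P.BtB) / lamMinPos (chebMat P.W) ^ 2) •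
      ((chebMat P.W * chebMat P.W) ⊗ₖ (1 : Matrix (Fin d) (Fin d) ℝ))

/-! ### Cost model

Every node stores a linear subspace of `ℝ^d` and one of `ℝ^p` (linear combinations of vectors that
a node stores are free). A dual oracle step lets each node call its own dual oracle once, a
communication step lets each node send one stored vector of `ℝ^d` to all its neighbours, and a
multiplication step lets each node multiply one stored vector by `B` or by `Bᵀ`. -/

structure Memory (m d p : ℕ) where
  primal : Fin m → Submodule ℝ (Vec (Fin d))
  aux : Fin m → Submodule ℝ (Vec (Fin p))

/-- `Run P s₀ s a c b`: from the memory `s₀` the network can reach the memory `s` with `a` dual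
oracle calls at each node, `c` communications, and `b` multiplications by `B` or `Bᵀ` at each
node. -/
inductive Run {m d p : ℕ} (P : Problem m d p) (s₀ : Memory m d p) :
    Memory m d p → ℕ → ℕ → ℕ → Prop
  | init : Run P s₀ s₀ 0 0 0
  | oracle {s : Memory m d p} {a c b : ℕ} (h : Run P s₀ s a c b) (u : Fin m → Vec (Fin d))
      (hu : ∀ i, u i ∈ s.primal i) :
      Run P s₀ ⟨fun i => s.primal i ⊔ Submodule.span ℝ {dualOracle (P.f i) (u i)}, s.aux⟩
        (a + 1) c b
  | comm {s : Memory m d p} {a c b : ℕ} (h : Run P s₀ s a c b) (u : Fin m → Vec (Fin d))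
      (hu : ∀ i, u i ∈ s.primal i) :
      Run P s₀ ⟨fun i => s.primal i ⊔ Submodule.span ℝ (u '' {j | P.graph.Adj i j}), s.aux⟩
        a (c + 1) b
  | mulB {s : Memory m d p} {a c b : ℕ} (h : Run P s₀ s a c b) (u : Fin m → Vec (Fin d))
      (hu : ∀ i, u i ∈ s.primal i) :
      Run P s₀ ⟨s.primal, fun i => s.aux i ⊔ Submodule.span ℝ {P.B.toEuclideanLin (u i)}⟩
        a c (b + 1)
  | mulBT {s : Memory m d p} {a c b : ℕ} (h : Run P s₀ s a c b) (t : Fin m → Vec (Fin p))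
      (ht : ∀ i, t i ∈ s.aux i) :
      Run P s₀ ⟨fun i => s.primal i ⊔ Submodule.span ℝ {P.B.transpose.toEuclideanLin (t i)},
        s.aux⟩ a c (b + 1)

/-- The vector `x = col(x_1, …, x_m)` can be computed, node `i` holding `x_i`, from the memory `s₀`
at the cost `(a, c, b)`. -/
def Computes {m d p : ℕ} (P : Problem m d p) (s₀ : Memory m d p) (x : Vec (Fin m × Fin d))
    (a c b : ℕ) : Prop :=
  ∃ s, Run P s₀ s a c b ∧ ∀ i, block x i ∈ s.primal i

/-- Node `i` stores only the `i`-th block of `p₀`. -/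
def primalMemory {m d : ℕ} (p : ℕ) (p₀ : Vec (Fin m × Fin d)) : Memory m d p :=
  ⟨fun i => Submodule.span ℝ {block p₀ i}, fun _ => ⊥⟩

/-- Node `i` stores only the `i`-th blocks of the two components of `y₀ = (u₀, v₀)`. -/
def dualMemory {m d p : ℕ} (y₀ : Vec (Problem.DualIdx m d p)) : Memory m d p :=
  ⟨fun i => Submodule.span ℝ {WithLp.toLp 2 fun j => y₀ (Sum.inr (i, j))},
    fun i => Submodule.span ℝ {WithLp.toLp 2 fun j => y₀ (Sum.inl (i, j))}⟩

end GloballyDual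

end

/-!
Strong convexity makes `F*` smooth and smoothness makes `F*` strongly convex, and since
`Φ = F* ∘ Aᵀ`, the dual function is smooth with constant `λ_max(AᵀA) / μ` and strongly convex with
constant `λ⁺_min(AᵀA) / L` on `(ker Aᵀ)ᗮ = range A`. Nesterov's method never leaves `y₀ + range A`,
and it is analysed there with the energy `φ(y^k) - φ(y*) + κ/2 ‖w^k - y*‖²`, which contracts by the
factor `1 - √(κ/ℓ)`.

A positive semidefinite `H` with the kernel of `AᵀA` can be factored as `H = RᵀR`, and then
`p^k = Rᵀ y^k` turns Nesterov's method for `F* ∘ Rᵀ` into the globally dual method with matrix `H`.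
A dual gap `δ` means `‖x(p^k) - x*‖² ≤ 2δ/μ`, hence an `ε`-solution.

`AᵀA = I ⊗ BᵀB + γ² W² ⊗ I` is a sum of two commuting matrices, so its spectrum consists of the sums
of their eigenvalues; because `BᵀB` and `W` are both singular, the smallest positive sum is the
smaller of the two smallest positive eigenvalues. The Chebyshev polynomial of degree `⌈√χ⌉` maps the
positive spectrum into an interval around `1` that is universally bounded away from `0`, since
`T_K(1 + 2/(χ - 1))` is bounded below by a universal constant larger than `1`. Evaluating these
polynomials by Horner's scheme costs as many communications or multiplications as their degree.
-/

noncomputable section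

namespace GloballyDual

/-! ### Smooth and strongly convex functions -/

section Convex

theorem hasGradientAt_of_abs_sub_le {E : Type*} [NormedAddCommGroup E] [InnerProductSpace ℝ E]
    [CompleteSpace E] {φ : E → ℝ} {g x : E} {c : ℝ}
    (h : ∀ y, |φ y - φ x - ⟪g, y - x⟫| ≤ c * ‖y - x‖ ^ 2) : HasGradientAt φ g x := by
  rw [hasGradientAt_iff_isLittleO]
  refine Asymptotics.IsBigO.trans_isLittleO (g := fun y => ‖y - x‖ ^ 2) ?_
    (Asymptotics.isLittleO_pow_sub_sub x one_lt_two)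
  exact Asymptotics.IsBigO.of_bound c (Filter.Eventually.of_forall fun y => by simpa using h y)

theorem gradient_mem_orthogonal_of_isMinOn {E : Type*} [NormedAddCommGroup E]
    [InnerProductSpace ℝ E] [CompleteSpace E] {f : E → ℝ} {V : Submodule ℝ E} {x : E}
    (hf : DifferentiableAt ℝ f x) (hx : x ∈ V) (hmin : IsMinOn f V x) : ∇ f x ∈ Vᗮ := by
  refine (Submodule.mem_orthogonal' _ _).2 fun v hv => ?_
  rw [inner_gradient_left]
  exact hmin.hasLineDerivAt_eq_zero (hf.hasFDerivAt.hasLineDerivAt v)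
    (Filter.Eventually.of_forall fun t => V.add_mem hx (V.smul_mem t hv))

theorem exists_isMinOn_of_quadratic_growth {E : Type*} [NormedAddCommGroup E]
    [InnerProductSpace ℝ E] [FiniteDimensional ℝ E] {φ : E → ℝ} (hφ : Continuous φ) {a c : ℝ}
    (ha : 0 < a) {g : E} (hgrowth : ∀ x, c + ⟪g, x⟫ + a * ‖x‖ ^ 2 ≤ φ x) (V : Submodule ℝ E) :
    ∃ x ∈ V, IsMinOn φ V x := by
  have quadratic_tendsto :
      Filter.Tendsto (fun t : ℝ => c + t * (a * t - ‖g‖)) Filter.atTop Filter.atTop := by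
    refine Filter.tendsto_atTop_add_const_left _ _ (Filter.tendsto_id.atTop_mul_atTop₀ ?_)
    exact Filter.tendsto_atTop_add_const_right _ (-‖g‖) (Filter.tendsto_id.const_mul_atTop ha)
  have coercive : Filter.Tendsto (fun x : V => φ x) (Filter.cocompact V) Filter.atTop := by
    refine Filter.tendsto_atTop_mono (fun x => ?_)
      (quadratic_tendsto.comp (tendsto_norm_cocompact_atTop (E := V)))
    have cauchy_schwarz := neg_le_of_abs_le (abs_real_inner_le_norm g (x : E))
    calc c + ‖x‖ * (a * ‖x‖ - ‖g‖)
        = c + -(‖g‖ * ‖(x : E)‖) + a * ‖(x : E)‖ ^ 2 := by rw [Submodule.coe_norm]; ring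
      _ ≤ c + ⟪g, (x : E)⟫ + a * ‖(x : E)‖ ^ 2 := by gcongr
      _ ≤ φ x := hgrowth x
  obtain ⟨x, hx⟩ := (hφ.comp continuous_subtype_val).exists_forall_le coercive
  exact ⟨x, x.2, fun y hy => hx ⟨y, hy⟩⟩

variable {E : Type} [NormedAddCommGroup E] [InnerProductSpace ℝ E] [CompleteSpace E]
  {f : E → ℝ} {μ L : ℝ}

namespace IsStronglyConvexOn

theorem exists_isMinOn [FiniteDimensional ℝ E] (hf : IsStronglyConvexOn Set.univ μ f)
    (hμ : 0 < μ) (q : E) (V : Submodule ℝ E) : ∃ x ∈ V, IsMinOn (fun x => f x - ⟪q, x⟫) V x := by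
  refine exists_isMinOn_of_quadratic_growth (c := f 0) (g := ∇ f 0 - q)
    (hf.1.continuous.sub (continuous_const.inner continuous_id)) (half_pos hμ) (fun x => ?_) V
  have growth := hf.2 0 trivial x trivial
  rw [sub_zero] at growth
  change f 0 + ⟪∇ f 0 - q, x⟫ + μ / 2 * ‖x‖ ^ 2 ≤ f x - ⟪q, x⟫
  rw [inner_sub_left]
  linarith

theorem isMaxOn_iff_gradient_eq (hf : IsStronglyConvexOn Set.univ μ f) (hμ : 0 ≤ μ) (q z : E) :
    IsMaxOn (fun x => ⟪q, x⟫ - f x) Set.univ z ↔ ∇ f z = q := by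
  refine ⟨fun h => ext_inner_right ℝ fun v => ?_, ?_⟩
  · have derivative : ⟪q, v⟫ - fderiv ℝ f z v = 0 := h.hasLineDerivAt_eq_zero
      (((innerSL ℝ q).hasFDerivAt.sub (hf.1 z).hasFDerivAt).hasLineDerivAt v)
      (Filter.Eventually.of_forall fun _ => trivial)
    rw [inner_gradient_left, ← sub_eq_zero.1 derivative]
  · rintro rfl x -
    have tangent := hf.2 z trivial x trivial
    rw [inner_sub_right] at tangent
    have : 0 ≤ μ / 2 * ‖x - z‖ ^ 2 := by positivity
    change ⟪∇ f z, x⟫ - f x ≤ ⟪∇ f z, z⟫ - f z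
    linarith

theorem isGreatest_conjugate (hf : IsStronglyConvexOn Set.univ μ f) (hμ : 0 ≤ μ) (z : E) :
    IsGreatest (Set.range fun x => ⟪∇ f z, x⟫ - f x) (⟪∇ f z, z⟫ - f z) := by
  refine ⟨⟨z, rfl⟩, ?_⟩
  rintro _ ⟨x, rfl⟩
  exact (hf.isMaxOn_iff_gradient_eq hμ _ z).2 rfl (Set.mem_univ x)

theorem conjugate_gradient (hf : IsStronglyConvexOn Set.univ μ f) (hμ : 0 ≤ μ) (z : E) :
    conjugate f (∇ f z) = ⟪∇ f z, z⟫ - f z :=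
  (hf.isGreatest_conjugate hμ z).csSup_eq

variable [FiniteDimensional ℝ E]

theorem exists_gradient_eq (hf : IsStronglyConvexOn Set.univ μ f) (hμ : 0 < μ) (q : E) :
    ∃ z, ∇ f z = q := by
  obtain ⟨z, -, hz⟩ := hf.exists_isMinOn hμ q ⊤
  refine ⟨z, (hf.isMaxOn_iff_gradient_eq hμ.le q z).1 ?_⟩
  simpa only [Submodule.top_coe, neg_sub] using hz.neg

theorem le_conjugate (hf : IsStronglyConvexOn Set.univ μ f) (hμ : 0 < μ) (q x : E) :
    ⟪q, x⟫ - f x ≤ conjugate f q := by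
  obtain ⟨z, rfl⟩ := hf.exists_gradient_eq hμ q
  rw [hf.conjugate_gradient hμ.le]
  exact (hf.isGreatest_conjugate hμ.le z).2 ⟨x, rfl⟩

theorem tangent_le_conjugate (hf : IsStronglyConvexOn Set.univ μ f) (hμ : 0 < μ) (z q : E) :
    conjugate f (∇ f z) + ⟪z, q - ∇ f z⟫ ≤ conjugate f q := by
  have fenchel_young := hf.le_conjugate hμ q z
  rw [hf.conjugate_gradient hμ.le, inner_sub_right z, real_inner_comm q z,
    real_inner_comm (∇ f z) z]
  linarith

theorem conjugate_le_quadratic (hf : IsStronglyConvexOn Set.univ μ f) (hμ : 0 < μ) (z q : E) :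
    conjugate f q ≤ conjugate f (∇ f z) + ⟪z, q - ∇ f z⟫ + μ⁻¹ / 2 * ‖q - ∇ f z‖ ^ 2 := by
  obtain ⟨x, rfl⟩ := hf.exists_gradient_eq hμ q
  rw [hf.conjugate_gradient hμ.le, hf.conjugate_gradient hμ.le]
  have strong := hf.2 z trivial x trivial
  set g := ∇ f z
  set q := ∇ f x
  have young : ⟪q - g, x - z⟫ ≤ μ / 2 * ‖x - z‖ ^ 2 + μ⁻¹ / 2 * ‖q - g‖ ^ 2 := by
    have square_nonneg : 0 ≤ μ⁻¹ / 2 * ‖(q - g) - μ • (x - z)‖ ^ 2 := by positivity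
    rw [norm_sub_sq_real, norm_smul, inner_smul_right, Real.norm_of_nonneg hμ.le] at square_nonneg
    have expand : μ⁻¹ / 2 * (‖q - g‖ ^ 2 - 2 * (μ * ⟪q - g, x - z⟫) + (μ * ‖x - z‖) ^ 2)
        = μ⁻¹ / 2 * ‖q - g‖ ^ 2 - ⟪q - g, x - z⟫ + μ / 2 * ‖x - z‖ ^ 2 := by field_simp
    linarith
  simp only [inner_sub_left, inner_sub_right] at *
  rw [real_inner_comm q z, real_inner_comm g z]
  linarith

theorem hasGradientAt_conjugate (hf : IsStronglyConvexOn Set.univ μ f) (hμ : 0 < μ) (z : E) :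
    HasGradientAt (conjugate f) z (∇ f z) := by
  refine hasGradientAt_of_abs_sub_le (c := μ⁻¹ / 2) fun q => ?_
  have lower := hf.tangent_le_conjugate hμ z q
  have upper := hf.conjugate_le_quadratic hμ z q
  rw [abs_of_nonneg] <;> linarith

theorem dualOracle_gradient (hf : IsStronglyConvexOn Set.univ μ f) (hμ : 0 < μ) (z : E) :
    dualOracle f (∇ f z) = z :=
  (hf.hasGradientAt_conjugate hμ z).gradient

theorem gradient_dualOracle (hf : IsStronglyConvexOn Set.univ μ f) (hμ : 0 < μ) (q : E) :
    ∇ f (dualOracle f q) = q := by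
  obtain ⟨z, rfl⟩ := hf.exists_gradient_eq hμ q
  rw [hf.dualOracle_gradient hμ]

theorem isMaxOn_iff_eq_dualOracle (hf : IsStronglyConvexOn Set.univ μ f) (hμ : 0 < μ) (q z : E) :
    IsMaxOn (fun x => ⟪q, x⟫ - f x) Set.univ z ↔ z = dualOracle f q := by
  rw [hf.isMaxOn_iff_gradient_eq hμ.le]
  constructor
  · rintro rfl
    rw [hf.dualOracle_gradient hμ]
  · rintro rfl
    exact hf.gradient_dualOracle hμ q

theorem isSmooth_conjugate (hf : IsStronglyConvexOn Set.univ μ f) (hμ : 0 < μ) :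
    IsSmooth μ⁻¹ (conjugate f) := by
  refine ⟨fun q => ?_, fun q r => ?_⟩ <;> obtain ⟨z, rfl⟩ := hf.exists_gradient_eq hμ q
  · exact (hf.hasGradientAt_conjugate hμ z).differentiableAt
  · rw [(hf.hasGradientAt_conjugate hμ z).gradient]
    exact hf.conjugate_le_quadratic hμ z r

theorem isStronglyConvexOn_conjugate (hf : IsStronglyConvexOn Set.univ μ f) (hμ : 0 < μ)
    (hL : 0 < L) (hs : IsSmooth L f) : IsStronglyConvexOn Set.univ L⁻¹ (conjugate f) := by
  refine ⟨(hf.isSmooth_conjugate hμ).1, fun q _ r _ => ?_⟩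
  obtain ⟨z, rfl⟩ := hf.exists_gradient_eq hμ q
  rw [(hf.hasGradientAt_conjugate hμ z).gradient, hf.conjugate_gradient hμ.le]
  -- The supremum defining `f* r` is bounded below at the gradient step from `z` towards `r`.
  have fenchel_young := hf.le_conjugate hμ r (z + L⁻¹ • (r - ∇ f z))
  have smooth := hs.2 z (z + L⁻¹ • (r - ∇ f z))
  set g := ∇ f z
  rw [add_sub_cancel_left, norm_smul, inner_smul_right,
    Real.norm_of_nonneg (by positivity)] at smooth
  rw [inner_add_right, inner_smul_right] at fenchel_young
  have linear_term : L⁻¹ * ⟪r, r - g⟫ - L⁻¹ * ⟪g, r - g⟫ = L⁻¹ * ‖r - g‖ ^ 2 := by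
    rw [← mul_sub, ← inner_sub_left, real_inner_self_eq_norm_sq]
  have quadratic_term :
      L / 2 * (L⁻¹ * ‖r - g‖) ^ 2 = L⁻¹ * ‖r - g‖ ^ 2 - L⁻¹ / 2 * ‖r - g‖ ^ 2 := by
    field_simp
    ring
  rw [inner_sub_right z, real_inner_comm r z, real_inner_comm g z]
  linarith

theorem norm_dualOracle_sub_sq_le (hf : IsStronglyConvexOn Set.univ μ f) (hμ : 0 < μ) (q z : E) :
    μ / 2 * ‖dualOracle f q - z‖ ^ 2 ≤ conjugate f q - (⟪q, z⟫ - f z) := by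
  obtain ⟨x, rfl⟩ := hf.exists_gradient_eq hμ q
  rw [hf.dualOracle_gradient hμ, hf.conjugate_gradient hμ.le, norm_sub_rev]
  have strong := hf.2 x trivial z trivial
  rw [inner_sub_right] at strong
  linarith

end IsStronglyConvexOn

theorem IsSmooth.sub_le (hs : IsSmooth L f) (x y : E) :
    f y - f x ≤ ‖∇ f x‖ * ‖y - x‖ + L / 2 * ‖y - x‖ ^ 2 := by
  linarith [hs.2 x y, real_inner_le_norm (∇ f x) (y - x)]

theorem IsSmooth.le_of_isStronglyConvexOn [Nontrivial E] (hs : IsSmooth L f)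
    (hf : IsStronglyConvexOn Set.univ μ f) : μ ≤ L := by
  obtain ⟨x, hx⟩ := exists_ne (0 : E)
  have lower := hf.2 0 trivial x trivial
  have upper := hs.2 0 x
  have : 0 < ‖x - 0‖ ^ 2 := by
    rw [sub_zero]
    positivity
  nlinarith

section Composition

variable {G : Type} [NormedAddCommGroup G] [InnerProductSpace ℝ G] [CompleteSpace G]
  {S : G →L[ℝ] E} {a b : ℝ}

theorem hasGradientAt_comp_clm {g : E} {y : G} (hf : HasGradientAt f g (S y)) :
    HasGradientAt (fun y => f (S y)) (S.adjoint g) y := by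
  rw [hasGradientAt_iff_hasFDerivAt] at hf ⊢
  have chain_rule : HasFDerivAt (fun y => f (S y)) _ y := hf.comp y S.hasFDerivAt
  refine chain_rule.congr_fderiv (ContinuousLinearMap.ext fun v => ?_)
  exact (S.adjoint_inner_left v g).symm

theorem IsSmooth.comp_clm (hf : IsSmooth L f) (hL : 0 ≤ L) (hS : ‖S‖ ^ 2 ≤ a) :
    IsSmooth (a * L) fun y => f (S y) := by
  refine ⟨hf.1.comp S.differentiable, fun x y => ?_⟩
  have norm_sq_le : ‖S (y - x)‖ ^ 2 ≤ a * ‖y - x‖ ^ 2 := by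
    calc ‖S (y - x)‖ ^ 2 ≤ (‖S‖ * ‖y - x‖) ^ 2 := by gcongr; exact S.le_opNorm _
      _ ≤ a * ‖y - x‖ ^ 2 := by rw [mul_pow]; gcongr
  rw [(hasGradientAt_comp_clm (hf.1 (S x)).hasGradientAt).gradient, S.adjoint_inner_left, map_sub]
  calc f (S y) ≤ f (S x) + ⟪∇ f (S x), S y - S x⟫ + L / 2 * ‖S (y - x)‖ ^ 2 :=
        map_sub S y x ▸ hf.2 (S x) (S y)
    _ ≤ f (S x) + ⟪∇ f (S x), S y - S x⟫ + L / 2 * (a * ‖y - x‖ ^ 2) := by gcongr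
    _ = f (S x) + ⟪∇ f (S x), S y - S x⟫ + a * L / 2 * ‖y - x‖ ^ 2 := by ring

theorem IsStronglyConvexOn.comp_clm (hf : IsStronglyConvexOn Set.univ μ f) (hμ : 0 ≤ μ)
    {s : Set G} (hS : ∀ x ∈ s, ∀ y ∈ s, b * ‖y - x‖ ^ 2 ≤ ‖S (y - x)‖ ^ 2) :
    IsStronglyConvexOn s (b * μ) fun y => f (S y) := by
  refine ⟨hf.1.comp S.differentiable, fun x hx y hy => ?_⟩
  rw [(hasGradientAt_comp_clm (hf.1 (S x)).hasGradientAt).gradient, S.adjoint_inner_left, map_sub]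
  calc f (S x) + ⟪∇ f (S x), S y - S x⟫ + b * μ / 2 * ‖y - x‖ ^ 2
      = f (S x) + ⟪∇ f (S x), S y - S x⟫ + μ / 2 * (b * ‖y - x‖ ^ 2) := by ring
    _ ≤ f (S x) + ⟪∇ f (S x), S y - S x⟫ + μ / 2 * ‖S (y - x)‖ ^ 2 := by
        gcongr
        exact hS x hx y hy
    _ ≤ f (S y) := map_sub S y x ▸ hf.2 (S x) trivial (S y) trivial

end Composition

end Convex

/-! ### Nesterov's method -/

section Accel

variable {E : Type} [NormedAddCommGroup E] [InnerProductSpace ℝ E]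

/-- The extrapolated point at which Nesterov's method evaluates the gradient when its last two
iterates are `x = (y^k, y^{k-1})`. -/
def extrapolation (β : ℝ) (x : E × E) : E := x.1 + β • (x.1 - x.2)

theorem accel_succ (g : E → E) (η β : ℝ) (y₀ : E) (k : ℕ) :
    accel g η β y₀ (k + 1) =
      (extrapolation β (accel g η β y₀ k) - η • g (extrapolation β (accel g η β y₀ k)),
        (accel g η β y₀ k).1) := rfl

theorem map_accel {E' : Type} [NormedAddCommGroup E'] [InnerProductSpace ℝ E'] (S : E →ₗ[ℝ] E')
    {g : E → E} {g' : E' → E'} (hS : ∀ y, S (g y) = g' (S y)) (η β : ℝ) (y₀ : E) (k : ℕ) :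
    Prod.map S S (accel g η β y₀ k) = accel g' η β (S y₀) k := by
  induction k with
  | zero => rfl
  | succ k ih =>
    simp only [accel_succ, ← ih, extrapolation, Prod.map, map_sub, map_add, map_smul, hS]

theorem extrapolation_sub_mem {V : Submodule ℝ E} {y₀ : E} {x : E × E} (β : ℝ)
    (hx : x.1 - y₀ ∈ V ∧ x.2 - y₀ ∈ V) : extrapolation β x - y₀ ∈ V := by
  have : extrapolation β x - y₀ = (x.1 - y₀) + β • ((x.1 - y₀) - (x.2 - y₀)) := by
    unfold extrapolation
    module
  exact this ▸ V.add_mem hx.1 (V.smul_mem _ (V.sub_mem hx.1 hx.2))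

theorem accel_sub_mem {V : Submodule ℝ E} {g : E → E} (hg : ∀ x, g x ∈ V) (η β : ℝ) (y₀ : E)
    (k : ℕ) : (accel g η β y₀ k).1 - y₀ ∈ V ∧ (accel g η β y₀ k).2 - y₀ ∈ V := by
  induction k with
  | zero => simp [accel]
  | succ k ih =>
    refine ⟨?_, ih.1⟩
    rw [accel_succ, sub_right_comm]
    exact V.sub_mem (extrapolation_sub_mem β ih) (V.smul_mem _ (hg _))

/-- The estimate point `y^{k-1} + (y^k - y^{k-1}) / s` of the Lyapunov analysis of Nesterov's
method. -/
def estimatePoint (s : ℝ) (x : E × E) : E := x.2 + s⁻¹ • (x.1 - x.2)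

/-- The Lyapunov function of Nesterov's method for the comparison point `ys`. -/
def energy (φ : E → ℝ) (κ s : ℝ) (ys : E) (x : E × E) : ℝ :=
  φ x.1 - φ ys + κ / 2 * ‖estimatePoint s x - ys‖ ^ 2

variable {s : ℝ}

theorem one_add_smul_extrapolation (hs : 0 < s) (x : E × E) :
    (1 + s) • extrapolation ((1 - s) / (1 + s)) x = x.1 + s • estimatePoint s x := by
  unfold extrapolation estimatePoint
  match_scalars <;> field

theorem estimatePoint_gradient_step (hs : 0 < s) {ℓ : ℝ} (g : E) {y w z : E}
    (hz : (1 + s) • z = y + s • w) :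
    estimatePoint s (z - ℓ⁻¹ • g, y) = (1 - s) • w + s • z - (s * ℓ)⁻¹ • g := by
  obtain rfl : y = (1 + s) • z - s • w := eq_sub_of_add_eq hz.symm
  unfold estimatePoint
  match_scalars <;> field

theorem norm_sub_smul_sq (u g : E) (c : ℝ) :
    ‖u - c • g‖ ^ 2 = ‖u‖ ^ 2 - 2 * c * ⟪g, u⟫ + c ^ 2 * ‖g‖ ^ 2 := by
  rw [norm_sub_sq_real, norm_smul, inner_smul_right, mul_pow, Real.norm_eq_abs, sq_abs,
    real_inner_comm g]
  ring

theorem norm_convex_combination_sq_le (hs : 0 ≤ s) (hs1 : s ≤ 1) (u v : E) :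
    ‖(1 - s) • u + s • v‖ ^ 2 ≤ (1 - s) * ‖u‖ ^ 2 + s * ‖v‖ ^ 2 :=
  (convexOn_univ_norm.pow (fun _ _ => norm_nonneg _) 2).2 (Set.mem_univ u) (Set.mem_univ v)
    (sub_nonneg.2 hs1) hs (sub_add_cancel 1 s)

/-- One step of the Lyapunov analysis, in which `s² = κ / ℓ`. -/
theorem energy_gradient_step_le {φ : E → ℝ} {g z y w ys : E} {ℓ : ℝ} (hℓ : 0 < ℓ) (hs : 0 < s)
    (hs1 : s ≤ 1) (hz : (1 + s) • z = y + s • w)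
    (descent : φ (z - ℓ⁻¹ • g) ≤ φ z - ℓ⁻¹ / 2 * ‖g‖ ^ 2) (tangent : φ z + ⟪g, y - z⟫ ≤ φ y)
    (strong : φ z + ⟪g, ys - z⟫ + s ^ 2 * ℓ / 2 * ‖ys - z‖ ^ 2 ≤ φ ys) :
    energy φ (s ^ 2 * ℓ) s ys (z - ℓ⁻¹ • g, y) ≤
      (1 - s) * (φ y - φ ys + s ^ 2 * ℓ / 2 * ‖w - ys‖ ^ 2) := by
  set u := (1 - s) • (w - ys) + s • (z - ys) with hu
  have estimate_sub : estimatePoint s (z - ℓ⁻¹ • g, y) - ys = u - (s * ℓ)⁻¹ • g := by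
    rw [estimatePoint_gradient_step hs g hz, hu]
    module
  have norm_estimate : s ^ 2 * ℓ / 2 * ‖u - (s * ℓ)⁻¹ • g‖ ^ 2 =
      s ^ 2 * ℓ / 2 * ‖u‖ ^ 2 - s * ⟪g, u⟫ + ℓ⁻¹ / 2 * ‖g‖ ^ 2 := by
    rw [norm_sub_smul_sq]
    field
  have norm_u : s ^ 2 * ℓ / 2 * ‖u‖ ^ 2 ≤
      s ^ 2 * ℓ / 2 * ((1 - s) * ‖w - ys‖ ^ 2 + s * ‖ys - z‖ ^ 2) := by
    rw [norm_sub_rev ys z]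
    gcongr
    exact norm_convex_combination_sq_le hs.le hs1 _ _
  have linear_terms : s * ⟪g, u⟫ = -((1 - s) * ⟪g, y - z⟫ + s * ⟪g, ys - z⟫) := by
    obtain rfl : y = (1 + s) • z - s • w := eq_sub_of_add_eq hz.symm
    simp only [hu, inner_add_right, inner_sub_right, inner_smul_right]
    ring
  have weighted_tangent := mul_le_mul_of_nonneg_left tangent (sub_nonneg.2 hs1)
  have weighted_strong := mul_le_mul_of_nonneg_left strong hs.le
  rw [energy, estimate_sub, norm_estimate]
  linarith

variable [CompleteSpace E] {φ : E → ℝ} {ℓ κ : ℝ}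

theorem IsSmooth.gradient_step_le (hφ : IsSmooth ℓ φ) (hℓ : 0 < ℓ) (z : E) :
    φ (z - ℓ⁻¹ • ∇ φ z) ≤ φ z - ℓ⁻¹ / 2 * ‖∇ φ z‖ ^ 2 := by
  refine (hφ.2 z (z - ℓ⁻¹ • ∇ φ z)).trans_eq ?_
  rw [sub_sub_cancel_left, inner_neg_right, norm_neg, inner_smul_right, norm_smul, mul_pow,
    Real.norm_eq_abs, sq_abs, real_inner_self_eq_norm_sq]
  field

theorem momentum_eq (hκ : 0 < κ) (hℓ : 0 < ℓ) :
    (√ℓ - √κ) / (√ℓ + √κ) = (1 - √(κ / ℓ)) / (1 + √(κ / ℓ)) := by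
  have := Real.sqrt_pos.2 hℓ
  have := Real.sqrt_pos.2 hκ
  rw [Real.sqrt_div hκ.le]
  field

/-- The linear rate of Nesterov's method when strong convexity is only available along a subspace
that contains all gradients. -/
theorem accel_sub_le (hκ : 0 < κ) (hκℓ : κ ≤ ℓ) {V : Submodule ℝ E} {y₀ : E}
    (smooth : IsSmooth ℓ φ) (strong : IsStronglyConvexOn {x | x - y₀ ∈ V} κ φ)
    (hV : ∀ x, ∇ φ x ∈ V) {ys : E} (hys : ys - y₀ ∈ V) (k : ℕ) :
    φ (accel (∇ φ) (1 / ℓ) ((√ℓ - √κ) / (√ℓ + √κ)) y₀ k).1 - φ ys ≤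
      (1 - √(κ / ℓ)) ^ k * (φ y₀ - φ ys + κ / 2 * ‖y₀ - ys‖ ^ 2) := by
  have hℓ : 0 < ℓ := hκ.trans_le hκℓ
  rw [momentum_eq hκ hℓ, one_div]
  set s := √(κ / ℓ)
  have hs : 0 < s := Real.sqrt_pos.2 (div_pos hκ hℓ)
  have hs1 : s ≤ 1 := Real.sqrt_le_one.2 ((div_le_one hℓ).2 hκℓ)
  have hsκ : s ^ 2 * ℓ = κ := by
    rw [Real.sq_sqrt (div_pos hκ hℓ).le, div_mul_cancel₀ _ hℓ.ne']
  set x := accel (∇ φ) ℓ⁻¹ ((1 - s) / (1 + s)) y₀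
  have energy_le : ∀ k, energy φ κ s ys (x k) ≤ (1 - s) ^ k * energy φ κ s ys (y₀, y₀) := by
    intro k
    induction k with
    | zero => exact (one_mul _).ge
    | succ k ih =>
      have hx := accel_sub_mem hV ℓ⁻¹ ((1 - s) / (1 + s)) y₀ k
      have hz := extrapolation_sub_mem ((1 - s) / (1 + s)) hx
      set z := extrapolation ((1 - s) / (1 + s)) (x k)
      have tangent : φ z + ⟪∇ φ z, (x k).1 - z⟫ ≤ φ (x k).1 :=
        (le_add_of_nonneg_right (by positivity)).trans (strong.2 z hz _ hx.1)
      have step := energy_gradient_step_le (w := estimatePoint s (x k)) hℓ hs hs1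
        (one_add_smul_extrapolation hs (x k)) (smooth.gradient_step_le hℓ z) tangent
        (hsκ.symm ▸ strong.2 z hz ys hys)
      rw [hsκ] at step
      rw [pow_succ', mul_assoc]
      exact step.trans (mul_le_mul_of_nonneg_left ih (sub_nonneg.2 hs1))
  calc φ (x k).1 - φ ys ≤ energy φ κ s ys (x k) := le_add_of_nonneg_right (by positivity)
    _ ≤ (1 - s) ^ k * energy φ κ s ys (y₀, y₀) := energy_le k
    _ = (1 - s) ^ k * (φ y₀ - φ ys + κ / 2 * ‖y₀ - ys‖ ^ 2) := by simp [energy, estimatePoint]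

end Accel

section DualAccel

variable {E G : Type} [NormedAddCommGroup E] [InnerProductSpace ℝ E]
  [NormedAddCommGroup G] [InnerProductSpace ℝ G] [CompleteSpace G] {S : G →L[ℝ] E}

theorem exists_sub_mem_orthogonal_ker {p q : E} (hp : p ∈ S.range) (hq : q ∈ S.range) :
    ∃ y z, S y = p ∧ S z = q ∧ z - y ∈ (S.ker)ᗮ := by
  obtain ⟨y, rfl⟩ := hp
  obtain ⟨w, rfl⟩ := hq
  refine ⟨y, y + ((w - y) - S.ker.starProjection (w - y)), rfl, ?_, ?_⟩
  · have : S (S.ker.starProjection (w - y)) = 0 := S.ker.starProjection_apply_mem (w - y)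
    rw [map_add, map_sub, this, sub_zero, map_sub]
    exact add_sub_cancel _ _
  · rw [add_sub_cancel_left]
    exact S.ker.sub_starProjection_mem_orthogonal (w - y)

variable [FiniteDimensional ℝ E] [CompleteSpace E] {f : E → ℝ} {μ L a b : ℝ}

/-- The gradient `xs` of the conjugate at `∇ f xs` is orthogonal to `range S`, which removes the
first-order term of the initial gap. -/
theorem conjugate_sub_add_le (strong : IsStronglyConvexOn Set.univ μ f) (hμ : 0 < μ) (hμL : μ ≤ L)
    (hSb : ∀ y ∈ (S.ker)ᗮ, b * ‖y‖ ^ 2 ≤ ‖S y‖ ^ 2) {xs : E} (hxs : S.adjoint xs = 0) {y₀ ys : G}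
    (hys : S ys = ∇ f xs) (hsub : ys - y₀ ∈ (S.ker)ᗮ) :
    conjugate f (S y₀) - conjugate f (∇ f xs) + b / L / 2 * ‖y₀ - ys‖ ^ 2 ≤
      μ⁻¹ * ‖S y₀ - ∇ f xs‖ ^ 2 := by
  have upper := (strong.isSmooth_conjugate hμ).2 (∇ f xs) (S y₀)
  have : ⟪∇ (conjugate f) (∇ f xs), S y₀ - ∇ f xs⟫ = 0 := by
    rw [(strong.hasGradientAt_conjugate hμ xs).gradient, ← hys, ← map_sub,
      ← S.adjoint_inner_left, hxs, inner_zero_left]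
  have distance : b / L / 2 * ‖y₀ - ys‖ ^ 2 ≤ μ⁻¹ / 2 * ‖S y₀ - ∇ f xs‖ ^ 2 := by
    calc b / L / 2 * ‖y₀ - ys‖ ^ 2 = L⁻¹ / 2 * (b * ‖ys - y₀‖ ^ 2) := by
          rw [norm_sub_rev]
          ring
      _ ≤ L⁻¹ / 2 * ‖S (ys - y₀)‖ ^ 2 := by
          have := hμ.trans_le hμL
          gcongr
          exact hSb _ hsub
      _ ≤ μ⁻¹ / 2 * ‖S y₀ - ∇ f xs‖ ^ 2 := by
          rw [map_sub, hys, norm_sub_rev]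
          gcongr
  linarith

theorem conjugate_accel_sub_le (strong : IsStronglyConvexOn Set.univ μ f) (hμ : 0 < μ)
    (smooth : IsSmooth L f) (hμL : μ ≤ L) (hSa : ‖S‖ ^ 2 ≤ a) (hb : 0 < b) (hba : b ≤ a)
    (hSb : ∀ y ∈ (S.ker)ᗮ, b * ‖y‖ ^ 2 ≤ ‖S y‖ ^ 2) {p₀ xs : E} (hp₀ : p₀ ∈ S.range)
    (hxs : S.adjoint xs = 0) (hgrad : ∇ f xs ∈ S.range) (k : ℕ) :
    conjugate f (accel (fun q => S (S.adjoint (dualOracle f q))) (1 / (a / μ))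
        ((√(a / μ) - √(b / L)) / (√(a / μ) + √(b / L))) p₀ k).1 - conjugate f (∇ f xs) ≤
      (1 - √(b / L / (a / μ))) ^ k * (μ⁻¹ * ‖p₀ - ∇ f xs‖ ^ 2) := by
  have hL := hμ.trans_le hμL
  obtain ⟨y₀, ys, rfl, hys, hsub⟩ := exists_sub_mem_orthogonal_ker hp₀ hgrad
  have smooth_conj := strong.isSmooth_conjugate hμ
  have gradient_comp (y : G) :
      ∇ (fun y => conjugate f (S y)) y = S.adjoint (dualOracle f (S y)) :=
    (hasGradientAt_comp_clm (smooth_conj.1 (S y)).hasGradientAt).gradient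
  have smooth_comp : IsSmooth (a / μ) fun y => conjugate f (S y) :=
    smooth_conj.comp_clm (inv_nonneg.2 hμ.le) hSa
  have strong_comp : IsStronglyConvexOn {y | y - y₀ ∈ (S.ker)ᗮ} (b / L)
      fun y => conjugate f (S y) := by
    refine (strong.isStronglyConvexOn_conjugate hμ hL smooth).comp_clm (inv_nonneg.2 hL.le)
      fun x hx y hy => hSb _ ?_
    simpa only [sub_sub_sub_cancel_right] using (S.ker)ᗮ.sub_mem hy hx
  have gradient_mem (y : G) : ∇ (fun y => conjugate f (S y)) y ∈ (S.ker)ᗮ := by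
    refine (Submodule.mem_orthogonal _ _).2 fun v hv => ?_
    rw [gradient_comp, S.adjoint_inner_right, show S v = 0 from hv, inner_zero_left]
  have hκℓ : b / L ≤ a / μ := by gcongr; exact hb.le.trans hba
  have rate := accel_sub_le (div_pos hb hL) hκℓ smooth_comp strong_comp gradient_mem hsub k
  have intertwine := map_accel S.toLinearMap
    (g' := fun q => S (S.adjoint (dualOracle f q))) (fun y => congrArg S (gradient_comp y))
    (1 / (a / μ)) ((√(a / μ) - √(b / L)) / (√(a / μ) + √(b / L))) y₀ k
  calc _ = conjugate f (S (accel (∇ fun y => conjugate f (S y)) (1 / (a / μ))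
          ((√(a / μ) - √(b / L)) / (√(a / μ) + √(b / L))) y₀ k).1) - conjugate f (S ys) := by
        rw [hys]
        exact congrArg (conjugate f ·.1 - _) intertwine.symm
    _ ≤ _ := rate
    _ ≤ _ := by
        refine mul_le_mul_of_nonneg_left ?_ (pow_nonneg (sub_nonneg.2 ?_) k)
        · exact hys.symm ▸ conjugate_sub_add_le strong hμ hμL hSb hxs hys hsub
        · exact Real.sqrt_le_one.2 ((div_le_one (div_pos (hb.trans_le hba) hμ)).2 hκℓ)

end DualAccel

/-! ### Spectra of symmetric matrices -/

section Spectrum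

open Matrix Polynomial

variable {n : Type} [Fintype n] [DecidableEq n] {M : Matrix n n ℝ}

lemma exists_mem_spectrum_ne_zero (hM : M.IsHermitian) (h₀ : M ≠ 0) :
    ∃ l ∈ spectrum ℝ M, l ≠ 0 := by
  by_contra! h
  refine h₀ (hM.eigenvalues_eq_zero_iff.1 (funext fun i => h _ ?_))
  exact hM.spectrum_real_eq_range_eigenvalues ▸ Set.mem_range_self i

lemma isGreatest_lamMax (hM : M.IsHermitian) (h₀ : M ≠ 0) :
    IsGreatest (spectrum ℝ M) (lamMax M) := by
  obtain ⟨l, hl, -⟩ := exists_mem_spectrum_ne_zero hM h₀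
  have hfin := M.finite_real_spectrum
  exact ⟨Set.Nonempty.csSup_mem ⟨l, hl⟩ hfin, fun _ ha => le_csSup hfin.bddAbove ha⟩

lemma isLeast_lamMinPos (hM : M.IsHermitian) (h₀ : M ≠ 0) :
    IsLeast {l | l ∈ spectrum ℝ M ∧ l ≠ 0} (lamMinPos M) := by
  obtain ⟨l, hl⟩ := exists_mem_spectrum_ne_zero hM h₀
  have hfin : {l | l ∈ spectrum ℝ M ∧ l ≠ 0}.Finite :=
    M.finite_real_spectrum.subset fun _ h => h.1
  exact ⟨Set.Nonempty.csInf_mem ⟨l, hl⟩ hfin, fun _ ha => csInf_le hfin.bddBelow ha⟩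

lemma nonneg_of_mem_spectrum (hM : M.PosSemidef) {l : ℝ} (hl : l ∈ spectrum ℝ M) : 0 ≤ l :=
  (posSemidef_iff_isHermitian_and_spectrum_nonneg.1 hM).2 hl

lemma lamMinPos_pos (hM : M.PosSemidef) (h₀ : M ≠ 0) : 0 < lamMinPos M :=
  have h := (isLeast_lamMinPos hM.isHermitian h₀).1
  (nonneg_of_mem_spectrum hM h.1).lt_of_ne' h.2

lemma lamMinPos_le_lamMax (hM : M.IsHermitian) (h₀ : M ≠ 0) : lamMinPos M ≤ lamMax M :=
  (isGreatest_lamMax hM h₀).2 (isLeast_lamMinPos hM h₀).1.1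

lemma lamMax_pos (hM : M.PosSemidef) (h₀ : M ≠ 0) : 0 < lamMax M :=
  (lamMinPos_pos hM h₀).trans_le (lamMinPos_le_lamMax hM.isHermitian h₀)

lemma one_le_chi (hM : M.PosSemidef) (h₀ : M ≠ 0) : 1 ≤ chi M :=
  (one_le_div (lamMinPos_pos hM h₀)).2 (lamMinPos_le_lamMax hM.isHermitian h₀)

lemma spectrum_aeval (hM : M.IsHermitian) (q : ℝ[X]) :
    spectrum ℝ (aeval M q) = (q.eval ·) '' spectrum ℝ M := by
  have hM' : IsSelfAdjoint M := hM
  rw [← cfc_polynomial q M, cfc_map_spectrum ..]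

lemma posSemidef_aeval (hM : M.IsHermitian) {q : ℝ[X]} (hq : ∀ l ∈ spectrum ℝ M, 0 ≤ q.eval l) :
    (aeval M q).PosSemidef := by
  have hM' : IsSelfAdjoint M := hM
  refine posSemidef_iff_isHermitian_and_spectrum_nonneg.2 ⟨?_, ?_⟩
  · rw [← cfc_polynomial q M]
    exact cfc_predicate _ M
  · rw [spectrum_aeval hM]
    rintro _ ⟨l, hl, rfl⟩
    exact hq l hl

lemma exists_mul_aeval_eq_aeval (hM : M.IsHermitian) {q r : ℝ[X]}
    (h : ∀ l ∈ spectrum ℝ M, q.eval l = 0 → r.eval l = 0) :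
    ∃ R, R * aeval M q = aeval M r := by
  have hM' : IsSelfAdjoint M := hM
  have hcont (g : ℝ → ℝ) : ContinuousOn g (spectrum ℝ M) := M.finite_real_spectrum.continuousOn g
  refine ⟨cfc (fun l => r.eval l / q.eval l) M, ?_⟩
  rw [← cfc_polynomial q M, ← cfc_polynomial r M, ← cfc_mul _ _ M (hcont _) (hcont _)]
  exact cfc_congr fun l hl => div_mul_cancel_of_imp (h l hl)

lemma ker_toEuclideanLin_le_mul {j k : Type} [Fintype k] (R : Matrix j k ℝ) (M : Matrix k n ℝ) :
    LinearMap.ker M.toEuclideanLin ≤ LinearMap.ker (R * M).toEuclideanLin := by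
  classical
  intro x hx
  rw [LinearMap.mem_ker, toLpLin_mul_same, LinearMap.comp_apply, LinearMap.mem_ker.1 hx, map_zero]

lemma ker_toEuclideanLin_aeval (hM : M.IsHermitian) {q : ℝ[X]}
    (hq : ∀ l ∈ spectrum ℝ M, q.eval l = 0 ↔ l = 0) :
    LinearMap.ker (aeval M q).toEuclideanLin = LinearMap.ker M.toEuclideanLin := by
  obtain ⟨R, hR⟩ := exists_mul_aeval_eq_aeval hM (q := q) (r := X)
    fun l hl h => by rw [eval_X, (hq l hl).1 h]
  obtain ⟨R', hR'⟩ := exists_mul_aeval_eq_aeval hM (q := X) (r := q)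
    fun l hl h => (hq l hl).2 (by rwa [eval_X] at h)
  rw [aeval_X] at hR hR'
  refine le_antisymm ?_ ?_
  · simpa only [hR] using ker_toEuclideanLin_le_mul R (aeval M q)
  · simpa only [hR'] using ker_toEuclideanLin_le_mul R' M

end Spectrum

/-! ### Quadratic forms of positive semidefinite matrices -/

section QuadraticForm

open Matrix Polynomial

lemma transpose_mul_self_posSemidef {n k : Type} [Finite n] [Fintype k] (R : Matrix k n ℝ) :
    (Rᵀ * R).PosSemidef := by
  simpa using posSemidef_conjTranspose_mul_self R

variable {n k : Type} [Fintype n] {M N : Matrix n n ℝ}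

open scoped MatrixOrder in
lemma exists_eq_transpose_mul_self (hM : M.PosSemidef) : ∃ R : Matrix n n ℝ, M = Rᵀ * R := by
  classical
  obtain ⟨R, hR⟩ := CStarAlgebra.nonneg_iff_eq_star_mul_self.1 (nonneg_iff_posSemidef.2 hM)
  exact ⟨R, by rwa [star_eq_conjTranspose, conjTranspose_eq_transpose_of_trivial] at hR⟩

variable [Fintype k] [DecidableEq n]

lemma inner_toEuclideanLin_nonneg (hM : M.PosSemidef) (x : Vec n) :
    0 ≤ ⟪x, M.toEuclideanLin x⟫ :=
  (isPositive_toEuclideanLin_iff.2 hM).inner_nonneg_right x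

lemma inner_toEuclideanLin_comm [DecidableEq k] (R : Matrix n k ℝ) (x : Vec n) (y : Vec k) :
    ⟪x, R.toEuclideanLin y⟫ = ⟪Rᵀ.toEuclideanLin x, y⟫ := by
  rw [← conjTranspose_eq_transpose_of_trivial, toEuclideanLin_conjTranspose_eq_adjoint,
    LinearMap.adjoint_inner_left]

lemma inner_transpose_mul_self (R : Matrix k n ℝ) (x : Vec n) :
    ⟪x, (Rᵀ * R).toEuclideanLin x⟫ = ‖R.toEuclideanLin x‖ ^ 2 := by
  classical
  rw [toLpLin_mul_same, LinearMap.comp_apply, inner_toEuclideanLin_comm, transpose_transpose,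
    real_inner_self_eq_norm_sq]

lemma toEuclideanLin_eq_zero_of_inner_eq_zero (hM : M.PosSemidef) {x : Vec n}
    (hx : ⟪x, M.toEuclideanLin x⟫ = 0) : M.toEuclideanLin x = 0 := by
  obtain ⟨R, rfl⟩ := exists_eq_transpose_mul_self hM
  rw [inner_transpose_mul_self] at hx
  rw [toLpLin_mul_same, LinearMap.comp_apply, norm_eq_zero.1 (pow_eq_zero_iff two_ne_zero |>.1 hx),
    map_zero]

lemma ker_toEuclideanLin_transpose_mul_self (R : Matrix k n ℝ) :
    LinearMap.ker (Rᵀ * R).toEuclideanLin = LinearMap.ker R.toEuclideanLin := by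
  refine le_antisymm (fun x hx => ?_) (ker_toEuclideanLin_le_mul Rᵀ R)
  rw [LinearMap.mem_ker, ← norm_eq_zero, ← pow_eq_zero_iff two_ne_zero, ← inner_transpose_mul_self,
    LinearMap.mem_ker.1 hx, inner_zero_right]

lemma ker_toEuclideanLin_add (hM : M.PosSemidef) (hN : N.PosSemidef) :
    LinearMap.ker (M + N).toEuclideanLin =
      LinearMap.ker M.toEuclideanLin ⊓ LinearMap.ker N.toEuclideanLin := by
  ext x
  simp only [Submodule.mem_inf, LinearMap.mem_ker, map_add, LinearMap.add_apply]
  refine ⟨fun hx => ?_, fun ⟨hM, hN⟩ => by rw [hM, hN, add_zero]⟩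
  have h := congrArg (⟪x, ·⟫) hx
  simp only [inner_add_right, inner_zero_right] at h
  have hxM := inner_toEuclideanLin_nonneg hM x
  have hxN := inner_toEuclideanLin_nonneg hN x
  exact ⟨toEuclideanLin_eq_zero_of_inner_eq_zero hM (by linarith),
    toEuclideanLin_eq_zero_of_inner_eq_zero hN (by linarith)⟩

lemma inner_toEuclideanLin_le (hM : M.PosSemidef) (h₀ : M ≠ 0) (x : Vec n) :
    ⟪x, M.toEuclideanLin x⟫ ≤ lamMax M * ‖x‖ ^ 2 := by
  have hpos : (aeval M (C (lamMax M) - X)).PosSemidef :=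
    posSemidef_aeval hM.isHermitian fun l hl => by
      simpa using (isGreatest_lamMax hM.isHermitian h₀).2 hl
  have h := inner_toEuclideanLin_nonneg hpos x
  simp only [map_sub, aeval_C, aeval_X, Algebra.algebraMap_eq_smul_one, map_smul, toLpLin_one,
    LinearMap.sub_apply, LinearMap.smul_apply, LinearMap.id_apply, inner_sub_right,
    real_inner_smul_right, real_inner_self_eq_norm_sq] at h
  linarith

lemma lamMinPos_mul_inner_le (hM : M.PosSemidef) (h₀ : M ≠ 0) (x : Vec n) :
    lamMinPos M * ⟪x, M.toEuclideanLin x⟫ ≤ ‖M.toEuclideanLin x‖ ^ 2 := by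
  have hpos : (aeval M (X * X - C (lamMinPos M) * X)).PosSemidef :=
    posSemidef_aeval hM.isHermitian fun l hl => by
      rcases eq_or_ne l 0 with rfl | hl₀
      · simp
      · have := (isLeast_lamMinPos hM.isHermitian h₀).2 ⟨hl, hl₀⟩
        simpa using mul_le_mul_of_nonneg_right this (nonneg_of_mem_spectrum hM hl)
  have hMt : Mᵀ = M := hM.isHermitian
  have h := inner_toEuclideanLin_nonneg hpos x
  simp only [map_sub, map_mul, aeval_C, aeval_X, Algebra.algebraMap_eq_smul_one, smul_mul_assoc,
    one_mul, map_smul, LinearMap.sub_apply, LinearMap.smul_apply, inner_sub_right,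
    real_inner_smul_right] at h
  rw [← inner_transpose_mul_self, hMt]
  linarith

lemma adjoint_toEuclideanLin [DecidableEq k] (R : Matrix k n ℝ) :
    R.toEuclideanLin.toContinuousLinearMap.adjoint = Rᵀ.toEuclideanLin.toContinuousLinearMap := by
  refine ((ContinuousLinearMap.eq_adjoint_iff _ _).2 fun x y => ?_).symm
  exact (inner_toEuclideanLin_comm R x y).symm

lemma range_transpose_toEuclideanLin [DecidableEq k] (R : Matrix k n ℝ) :
    LinearMap.range Rᵀ.toEuclideanLin = (LinearMap.ker R.toEuclideanLin)ᗮ := by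
  rw [← conjTranspose_eq_transpose_of_trivial, toEuclideanLin_conjTranspose_eq_adjoint,
    LinearMap.orthogonal_ker]

lemma sq_norm_toEuclideanLin_le {R : Matrix k n ℝ} (h₀ : Rᵀ * R ≠ 0) :
    ‖R.toEuclideanLin.toContinuousLinearMap‖ ^ 2 ≤ lamMax (Rᵀ * R) := by
  have hpsd := transpose_mul_self_posSemidef R
  rw [← Real.le_sqrt (norm_nonneg _) (lamMax_pos hpsd h₀).le]
  refine ContinuousLinearMap.opNorm_le_bound _ (Real.sqrt_nonneg _) fun x => ?_
  refine abs_le_of_sq_le_sq' ?_ (by positivity) |>.2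
  rw [mul_pow, Real.sq_sqrt (lamMax_pos hpsd h₀).le, LinearMap.coe_toContinuousLinearMap',
    ← inner_transpose_mul_self]
  exact inner_toEuclideanLin_le hpsd h₀ x

lemma lamMinPos_mul_sq_norm_le [DecidableEq k] {R : Matrix k n ℝ} (h₀ : Rᵀ * R ≠ 0) {y : Vec k}
    (hy : y ∈ (LinearMap.ker Rᵀ.toEuclideanLin)ᗮ) :
    lamMinPos (Rᵀ * R) * ‖y‖ ^ 2 ≤ ‖Rᵀ.toEuclideanLin y‖ ^ 2 := by
  rw [← range_transpose_toEuclideanLin, transpose_transpose] at hy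
  obtain ⟨x, rfl⟩ := hy
  rw [← inner_transpose_mul_self, ← LinearMap.comp_apply, ← toLpLin_mul_same]
  exact lamMinPos_mul_inner_le (transpose_mul_self_posSemidef R) h₀ x

end QuadraticForm

section SingularPosSemidef

open Matrix Polynomial

variable {n k : Type} [Fintype n] [Fintype k] [DecidableEq n] [DecidableEq k]

/-- A nonzero singular positive semidefinite matrix, such as `W` and `BᵀB`. Its spectrum contains
`0` and is contained in `{0} ∪ [λ⁺_min, λ_max]`. -/
structure IsSingularPosSemidef (M : Matrix n n ℝ) : Prop where
  posSemidef : M.PosSemidef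
  ne_zero : M ≠ 0
  zero_mem_spectrum : 0 ∈ spectrum ℝ M

lemma ne_zero_of_mem_spectrum_of_ne_zero {M : Matrix n n ℝ} {l : ℝ} (hl : l ∈ spectrum ℝ M)
    (h₀ : l ≠ 0) : M ≠ 0 := by
  rintro rfl
  cases subsingleton_or_nontrivial (Matrix n n ℝ)
  · simp only [spectrum.of_subsingleton, Set.mem_empty_iff_false] at hl
  · simp only [spectrum.zero_eq, Set.mem_singleton_iff] at hl
    exact h₀ hl

namespace IsSingularPosSemidef

variable {M : Matrix n n ℝ} {N : Matrix k k ℝ}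

lemma isGreatest_lamMax (hM : IsSingularPosSemidef M) : IsGreatest (spectrum ℝ M) (lamMax M) :=
  GloballyDual.isGreatest_lamMax hM.posSemidef.isHermitian hM.ne_zero

lemma isLeast_lamMinPos (hM : IsSingularPosSemidef M) :
    IsLeast {l | l ∈ spectrum ℝ M ∧ l ≠ 0} (lamMinPos M) :=
  GloballyDual.isLeast_lamMinPos hM.posSemidef.isHermitian hM.ne_zero

lemma lamMinPos_pos (hM : IsSingularPosSemidef M) : 0 < lamMinPos M :=
  GloballyDual.lamMinPos_pos hM.posSemidef hM.ne_zero

lemma lamMinPos_le_lamMax (hM : IsSingularPosSemidef M) : lamMinPos M ≤ lamMax M :=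
  GloballyDual.lamMinPos_le_lamMax hM.posSemidef.isHermitian hM.ne_zero

lemma lamMax_pos (hM : IsSingularPosSemidef M) : 0 < lamMax M :=
  GloballyDual.lamMax_pos hM.posSemidef hM.ne_zero

lemma one_le_chi (hM : IsSingularPosSemidef M) : 1 ≤ chi M :=
  GloballyDual.one_le_chi hM.posSemidef hM.ne_zero

lemma mem_Icc_of_mem_spectrum (hM : IsSingularPosSemidef M) {l : ℝ} (hl : l ∈ spectrum ℝ M)
    (h₀ : l ≠ 0) : l ∈ Set.Icc (lamMinPos M) (lamMax M) :=
  ⟨hM.isLeast_lamMinPos.2 ⟨hl, h₀⟩, hM.isGreatest_lamMax.2 hl⟩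

lemma aeval (hM : IsSingularPosSemidef M) {q : ℝ[X]} (hq₀ : q.eval 0 = 0)
    (hq : ∀ l ∈ Set.Icc (lamMinPos M) (lamMax M), 0 < q.eval l) :
    IsSingularPosSemidef (aeval M q) where
  posSemidef := posSemidef_aeval hM.posSemidef.isHermitian fun l hl => by
    rcases eq_or_ne l 0 with rfl | h₀
    · exact hq₀.ge
    · exact (hq l (hM.mem_Icc_of_mem_spectrum hl h₀)).le
  ne_zero := by
    refine ne_zero_of_mem_spectrum_of_ne_zero (l := q.eval (lamMax M)) ?_
      (hq _ (Set.right_mem_Icc.2 hM.lamMinPos_le_lamMax)).ne'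
    rw [spectrum_aeval hM.posSemidef.isHermitian]
    exact Set.mem_image_of_mem _ hM.isGreatest_lamMax.1
  zero_mem_spectrum := by
    rw [spectrum_aeval hM.posSemidef.isHermitian]
    exact ⟨0, hM.zero_mem_spectrum, hq₀⟩

lemma chi_aeval_le (hM : IsSingularPosSemidef M) {q : ℝ[X]} (hq₀ : q.eval 0 = 0) {u v : ℝ}
    (hu : 0 < u) (hq : ∀ l ∈ Set.Icc (lamMinPos M) (lamMax M), q.eval l ∈ Set.Icc u v) :
    chi (Polynomial.aeval M q) ≤ v / u := by
  have hN := hM.aeval hq₀ fun l hl => hu.trans_le (hq l hl).1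
  have hmem {l : ℝ} (hl : l ∈ spectrum ℝ (Polynomial.aeval M q)) (h₀ : l ≠ 0) :
      l ∈ Set.Icc u v := by
    rw [spectrum_aeval hM.posSemidef.isHermitian] at hl
    obtain ⟨a, ha, rfl⟩ := hl
    refine hq a (hM.mem_Icc_of_mem_spectrum ha ?_)
    rintro rfl
    exact h₀ hq₀
  have hmax := hmem hN.isGreatest_lamMax.1 hN.lamMax_pos.ne'
  have hmin := hmem hN.isLeast_lamMinPos.1.1 hN.isLeast_lamMinPos.1.2
  exact div_le_div₀ (hu.le.trans (hmax.1.trans hmax.2)) hmax.2 hu hmin.1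

end IsSingularPosSemidef

lemma spectrum_kroneckerSum {M : Matrix n n ℝ} {N : Matrix k k ℝ} (hM : M.IsHermitian)
    (hN : N.IsHermitian) : spectrum ℝ ((1 : Matrix k k ℝ) ⊗ₖ M + N ⊗ₖ (1 : Matrix n n ℝ)) =
      Set.image2 (· + ·) (spectrum ℝ M) (spectrum ℝ N) := by
  obtain ⟨U, hU⟩ : ∃ U : unitaryGroup n ℝ, U = hM.eigenvectorUnitary := ⟨_, rfl⟩
  obtain ⟨V, hV⟩ : ∃ V : unitaryGroup k ℝ, V = hN.eigenvectorUnitary := ⟨_, rfl⟩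
  let VU : unitaryGroup (k × n) ℝ := ⟨V.1 ⊗ₖ U.1, kronecker_mem_unitary V.2 U.2⟩
  have hMdiag : M = U.1 * diagonal hM.eigenvalues * star U.1 := hU ▸ hM.spectral_theorem
  have hNdiag : N = V.1 * diagonal hN.eigenvalues * star V.1 := hV ▸ hN.spectral_theorem
  have hdiag : (1 : Matrix k k ℝ) ⊗ₖ M + N ⊗ₖ (1 : Matrix n n ℝ) =
      VU.1 * diagonal (fun i : k × n => hM.eigenvalues i.2 + hN.eigenvalues i.1) * star VU.1 := by
    have hsum : diagonal (fun i : k × n => hM.eigenvalues i.2 + hN.eigenvalues i.1) =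
        (1 : Matrix k k ℝ) ⊗ₖ diagonal hM.eigenvalues +
          diagonal hN.eigenvalues ⊗ₖ (1 : Matrix n n ℝ) := by
      simp only [← diagonal_one, diagonal_kronecker_diagonal, diagonal_add, one_mul, mul_one]
    rw [hsum, mul_add, add_mul, star_eq_conjTranspose, conjTranspose_kronecker,
      ← star_eq_conjTranspose, ← star_eq_conjTranspose, ← mul_kronecker_mul, ← mul_kronecker_mul,
      ← mul_kronecker_mul, ← mul_kronecker_mul, ← hMdiag, ← hNdiag, mul_one, mul_one,
      Unitary.mul_star_self_of_mem U.2, Unitary.mul_star_self_of_mem V.2]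
  rw [hdiag, Unitary.spectrum_star_right_conjugate, spectrum_diagonal,
    hM.spectrum_real_eq_range_eigenvalues, hN.spectrum_real_eq_range_eigenvalues,
    Set.image2_range, ← (Equiv.prodComm k n).surjective.range_comp]
  rfl

end SingularPosSemidef

section WeightedGram

open Matrix Polynomial

variable {n k : Type} [Fintype n] [Fintype k] [DecidableEq n] [DecidableEq k]

/-- The matrix `I ⊗ G + c V² ⊗ I`. It is `AᵀA` for `G = BᵀB`, `V = W` and `c = γ²`, and it is the
matrix of the accelerated method for the Chebyshev polynomials in `BᵀB` and `W`. -/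
def weightedGram (G : Matrix n n ℝ) (V : Matrix k k ℝ) (c : ℝ) : Matrix (k × n) (k × n) ℝ :=
  (1 : Matrix k k ℝ) ⊗ₖ G + c • ((V * V) ⊗ₖ (1 : Matrix n n ℝ))

variable {G : Matrix n n ℝ} {V : Matrix k k ℝ} {c : ℝ}

lemma spectrum_weightedGram (hG : G.IsHermitian) (hV : V.IsHermitian) (c : ℝ) :
    spectrum ℝ (weightedGram G V c) =
      Set.image2 (fun a b => a + c * b ^ 2) (spectrum ℝ G) (spectrum ℝ V) := by
  have hcV : c • (V * V) = aeval V (C c * X ^ 2) := by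
    simp only [map_mul, aeval_C, aeval_X, Algebra.algebraMap_eq_smul_one, smul_mul_assoc,
      one_mul, sq]
  have hcV' : (c • (V * V)).IsHermitian := by
    have hV' : IsSelfAdjoint V := hV
    rw [hcV, ← cfc_polynomial _ V]
    exact cfc_predicate _ V
  rw [weightedGram, ← smul_kronecker, spectrum_kroneckerSum hG hcV', hcV, spectrum_aeval hV,
    Set.image2_image_right]
  simp only [eval_mul, eval_C, eval_pow, eval_X]

variable (hG : IsSingularPosSemidef G) (hV : IsSingularPosSemidef V)

include hG hV

lemma isGreatest_spectrum_weightedGram (hc : 0 ≤ c) :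
    IsGreatest (spectrum ℝ (weightedGram G V c)) (lamMax G + c * lamMax V ^ 2) := by
  rw [spectrum_weightedGram hG.posSemidef.isHermitian hV.posSemidef.isHermitian]
  refine ⟨Set.mem_image2_of_mem hG.isGreatest_lamMax.1 hV.isGreatest_lamMax.1, ?_⟩
  rintro _ ⟨a, ha, b, hb, rfl⟩
  have hb₀ := nonneg_of_mem_spectrum hV.posSemidef hb
  have hb₁ := hV.isGreatest_lamMax.2 hb
  have := hG.isGreatest_lamMax.2 ha
  beta_reduce
  gcongr

lemma isLeast_spectrum_weightedGram (hc : 0 < c) :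
    IsLeast {l | l ∈ spectrum ℝ (weightedGram G V c) ∧ l ≠ 0}
      (min (lamMinPos G) (c * lamMinPos V ^ 2)) := by
  have hG₀ := hG.lamMinPos_pos
  have hV₀ := hV.lamMinPos_pos
  rw [spectrum_weightedGram hG.posSemidef.isHermitian hV.posSemidef.isHermitian]
  refine ⟨⟨?_, by positivity⟩, ?_⟩
  · rcases min_choice (lamMinPos G) (c * lamMinPos V ^ 2) with h | h <;> rw [h]
    · exact ⟨_, hG.isLeast_lamMinPos.1.1, 0, hV.zero_mem_spectrum, by ring⟩
    · exact ⟨0, hG.zero_mem_spectrum, _, hV.isLeast_lamMinPos.1.1, zero_add _⟩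
  · rintro _ ⟨⟨a, ha, b, hb, rfl⟩, h₀⟩
    beta_reduce at h₀ ⊢
    have ha₀ := nonneg_of_mem_spectrum hG.posSemidef ha
    have hb₀ := nonneg_of_mem_spectrum hV.posSemidef hb
    rcases eq_or_ne a 0 with rfl | ha'
    · have hb' : b ≠ 0 := by
        rintro rfl
        exact h₀ (by ring)
      have := hV.isLeast_lamMinPos.2 ⟨hb, hb'⟩
      refine (min_le_right _ _).trans ?_
      rw [zero_add]
      gcongr
    · refine (min_le_left _ _).trans ((hG.isLeast_lamMinPos.2 ⟨ha, ha'⟩).trans ?_)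
      exact le_add_of_nonneg_right (by positivity)

lemma lamMax_weightedGram (hc : 0 ≤ c) :
    lamMax (weightedGram G V c) = lamMax G + c * lamMax V ^ 2 :=
  (isGreatest_spectrum_weightedGram hG hV hc).csSup_eq

lemma lamMinPos_weightedGram (hc : 0 < c) :
    lamMinPos (weightedGram G V c) = min (lamMinPos G) (c * lamMinPos V ^ 2) :=
  (isLeast_spectrum_weightedGram hG hV hc).csInf_eq

lemma lamMinPos_lt_lamMax_weightedGram (hc : 0 < c) :
    lamMinPos (weightedGram G V c) < lamMax (weightedGram G V c) := by
  have := hV.lamMax_pos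
  rw [lamMax_weightedGram hG hV hc.le, lamMinPos_weightedGram hG hV hc]
  refine (min_le_left _ _).trans_lt (hG.lamMinPos_le_lamMax.trans_lt ?_)
  exact lt_add_of_pos_right _ (by positivity)

lemma weightedGram_ne_zero (hc : 0 < c) : weightedGram G V c ≠ 0 :=
  have h := (isLeast_spectrum_weightedGram hG hV hc).1
  ne_zero_of_mem_spectrum_of_ne_zero h.1 h.2

lemma chi_weightedGram (hc : 0 < c) : chi (weightedGram G V c) =
    (lamMax G + c * lamMax V ^ 2) / min (lamMinPos G) (c * lamMinPos V ^ 2) := by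
  rw [chi, lamMax_weightedGram hG hV hc.le, lamMinPos_weightedGram hG hV hc]

lemma chi_weightedGram_opt :
    chi (weightedGram G V (lamMinPos G / lamMinPos V ^ 2)) = chi G + chi V ^ 2 := by
  have hG₀ := hG.lamMinPos_pos
  have hV₀ := hV.lamMinPos_pos
  rw [chi_weightedGram hG hV (by positivity), div_mul_cancel₀ _ (by positivity), min_self, chi, chi]
  field

lemma chi_add_sq_le_chi_weightedGram (hc : 0 < c) :
    chi G + chi V ^ 2 ≤ chi (weightedGram G V c) := by
  have hG₀ := hG.lamMinPos_pos
  have hV₀ := hV.lamMinPos_pos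
  have hG₁ := hG.lamMax_pos
  rw [chi_weightedGram hG hV hc, add_div, chi, chi]
  refine add_le_add ?_ ?_
  · gcongr
    exact min_le_left _ _
  · rw [div_pow, ← mul_div_mul_left _ _ hc.ne']
    gcongr
    exact min_le_right _ _

end WeightedGram

section Kernel

open Matrix Polynomial

lemma weightedGram_posSemidef {n k : Type} [Finite n] [Fintype k] [DecidableEq n]
    [DecidableEq k] {G : Matrix n n ℝ} {V : Matrix k k ℝ} {c : ℝ} (hG : G.PosSemidef)
    (hV : V.IsHermitian) (hc : 0 ≤ c) :
    (weightedGram G V c).PosSemidef := by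
  have hVV : (V * V).PosSemidef := by
    simpa only [show Vᵀ = V from hV] using transpose_mul_self_posSemidef V
  exact (PosSemidef.one.kronecker hG).add ((hVV.kronecker .one).smul hc)

variable {n k : Type} [Fintype n] [Fintype k] [DecidableEq n] [DecidableEq k]
  {G : Matrix n n ℝ} {V : Matrix k k ℝ} {c : ℝ}

lemma ker_weightedGram (hG : G.PosSemidef) (hV : V.IsHermitian) (hc : 0 < c) :
    LinearMap.ker (weightedGram G V c).toEuclideanLin =
      LinearMap.ker ((1 : Matrix k k ℝ) ⊗ₖ G).toEuclideanLin ⊓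
        LinearMap.ker (V ⊗ₖ (1 : Matrix n n ℝ)).toEuclideanLin := by
  have hVV : (V * V) ⊗ₖ (1 : Matrix n n ℝ) =
      (V ⊗ₖ (1 : Matrix n n ℝ))ᵀ * (V ⊗ₖ (1 : Matrix n n ℝ)) := by
    rw [← kroneckerMap_transpose, ← mul_kronecker_mul, transpose_one, one_mul,
      show Vᵀ = V from hV]
  have hpsd := transpose_mul_self_posSemidef (V ⊗ₖ (1 : Matrix n n ℝ))
  rw [weightedGram, hVV, ker_toEuclideanLin_add (PosSemidef.one.kronecker hG) (hpsd.smul hc.le),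
    map_smul, LinearMap.ker_smul _ _ hc.ne', ker_toEuclideanLin_transpose_mul_self]

/-- The embedding `M ↦ I ⊗ M` as a homomorphism of algebras. -/
def oneKronecker (k : Type) [Fintype k] [DecidableEq k] :
    Matrix n n ℝ →ₐ[ℝ] Matrix (k × n) (k × n) ℝ :=
  AlgHom.ofLinearMap
    { toFun := fun M => (1 : Matrix k k ℝ) ⊗ₖ M
      map_add' := kronecker_add 1
      map_smul' := fun r => kronecker_smul r 1 }
    one_kronecker_one fun M N => by
      simpa only [one_mul, LinearMap.coe_mk, AddHom.coe_mk] using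
        mul_kronecker_mul (1 : Matrix k k ℝ) (1 : Matrix k k ℝ) M N

/-- The embedding `M ↦ M ⊗ I` as a homomorphism of algebras. -/
def kroneckerOne (n : Type) [Fintype n] [DecidableEq n] :
    Matrix k k ℝ →ₐ[ℝ] Matrix (k × n) (k × n) ℝ :=
  AlgHom.ofLinearMap
    { toFun := fun M => M ⊗ₖ (1 : Matrix n n ℝ)
      map_add' := fun M N => add_kronecker M N 1
      map_smul' := fun r M => smul_kronecker r M 1 }
    one_kronecker_one fun M N => by
      simpa only [one_mul, LinearMap.coe_mk, AddHom.coe_mk] using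
        mul_kronecker_mul M N (1 : Matrix n n ℝ) (1 : Matrix n n ℝ)

lemma one_kronecker_aeval (M : Matrix n n ℝ) (q : ℝ[X]) :
    (1 : Matrix k k ℝ) ⊗ₖ aeval M q = aeval ((1 : Matrix k k ℝ) ⊗ₖ M) q :=
  (aeval_algHom_apply (oneKronecker k) M q).symm

lemma aeval_kronecker_one (M : Matrix k k ℝ) (q : ℝ[X]) :
    aeval M q ⊗ₖ (1 : Matrix n n ℝ) = aeval (M ⊗ₖ (1 : Matrix n n ℝ)) q :=
  (aeval_algHom_apply (kroneckerOne n) M q).symm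

lemma ker_one_kronecker_aeval (hG : G.PosSemidef) {q : ℝ[X]}
    (hq : ∀ l ∈ spectrum ℝ G, q.eval l = 0 ↔ l = 0) :
    LinearMap.ker ((1 : Matrix k k ℝ) ⊗ₖ aeval G q).toEuclideanLin =
      LinearMap.ker ((1 : Matrix k k ℝ) ⊗ₖ G).toEuclideanLin := by
  rw [one_kronecker_aeval]
  exact ker_toEuclideanLin_aeval (PosSemidef.one.kronecker hG).isHermitian
    fun l hl => hq l (AlgHom.spectrum_apply_subset (oneKronecker k) G hl)

lemma ker_aeval_kronecker_one (hV : V.PosSemidef) {q : ℝ[X]}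
    (hq : ∀ l ∈ spectrum ℝ V, q.eval l = 0 ↔ l = 0) :
    LinearMap.ker (aeval V q ⊗ₖ (1 : Matrix n n ℝ)).toEuclideanLin =
      LinearMap.ker (V ⊗ₖ (1 : Matrix n n ℝ)).toEuclideanLin := by
  rw [aeval_kronecker_one]
  exact ker_toEuclideanLin_aeval (hV.kronecker .one).isHermitian
    fun l hl => hq l (AlgHom.spectrum_apply_subset (kroneckerOne n) V hl)

end Kernel

/-! ### Chebyshev acceleration -/

section Chebyshev

open Polynomial

lemma cosh_log_add_one_div_sub_one {x : ℝ} (hx : 1 < x) :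
    Real.cosh (Real.log ((x + 1) / (x - 1))) = (x ^ 2 + 1) / (x ^ 2 - 1) := by
  have hx₀ : 0 < x - 1 := sub_pos.2 hx
  have : 0 < x + 1 := by linarith
  have hx₂ : x ^ 2 - 1 = (x - 1) * (x + 1) := by ring
  rw [Real.cosh_log (by positivity), hx₂]
  field

lemma three_le_pow_of_le {x : ℝ} {K : ℕ} (hx : 1 < x) (hK : x ≤ K) :
    3 ≤ ((x + 1) / (x - 1)) ^ K := by
  have hx₀ : 0 < x - 1 := sub_pos.2 hx
  have hK' : 1 ≤ K / (x - 1) := (one_le_div hx₀).2 (by linarith)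
  have hstep : (0 : ℝ) ≤ 2 / (x - 1) := by positivity
  calc (3 : ℝ) ≤ 1 + K * (2 / (x - 1)) := by
        rw [mul_div_left_comm]
        linarith
    _ ≤ (1 + 2 / (x - 1)) ^ K := one_add_mul_le_pow (by linarith) K
    _ = ((x + 1) / (x - 1)) ^ K := by
        congr 1
        field

/-- For `K ≥ x` the value `T_K(cosh θ) = cosh (K θ)` is bounded away from `1`, as
`e^θ = (x + 1)/(x - 1)`. -/
lemma three_halves_le_eval_T {x : ℝ} {K : ℕ} (hx : 1 < x) (hK : x ≤ K) :
    3 / 2 ≤ (Chebyshev.T ℝ (K : ℤ)).eval ((x ^ 2 + 1) / (x ^ 2 - 1)) := by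
  have : 0 < (x + 1) / (x - 1) := div_pos (by linarith) (by linarith)
  rw [← cosh_log_add_one_div_sub_one hx, Chebyshev.T_real_cosh, Real.cosh_eq, Int.cast_natCast,
    ← Real.log_pow, Real.exp_log (by positivity)]
  linarith [three_le_pow_of_le hx hK, Real.exp_pos (-Real.log (((x + 1) / (x - 1)) ^ K))]

variable {lo hi : ℝ} {K : ℕ}

lemma three_halves_le_eval_T_of_sqrt_le (hlo : 0 < lo) (hlt : lo < hi) (hK : √(hi / lo) ≤ K) :
    3 / 2 ≤ (Chebyshev.T ℝ (K : ℤ)).eval ((hi + lo) / (hi - lo)) := by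
  have hratio : 1 < hi / lo := (one_lt_div hlo).2 hlt
  have hsub : hi - lo ≠ 0 := sub_ne_zero.2 hlt.ne'
  have h := three_halves_le_eval_T (Real.lt_sqrt zero_le_one |>.2 (by simpa using hratio)) hK
  rwa [Real.sq_sqrt (by linarith), show (hi / lo + 1) / (hi / lo - 1) = (hi + lo) / (hi - lo) by
    field] at h

lemma eval_zero_chebPoly (hlo : 0 < lo) (hle : lo ≤ hi) (hK : √(hi / lo) ≤ K) :
    (chebPoly lo hi K).eval 0 = 0 := by
  rw [chebPoly]
  split_ifs with h
  · rw [eval_mul, eval_X, mul_zero]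
  · have hT := three_halves_le_eval_T_of_sqrt_le hlo (hle.lt_of_ne h) hK
    simp only [eval_sub, eval_one, eval_mul, eval_C, eval_comp, eval_X, mul_zero, sub_zero]
    rw [one_div_mul_cancel (by linarith), sub_self]

lemma abs_eval_T_rescale_le_one (hlt : lo < hi) {t : ℝ} (ht : t ∈ Set.Icc lo hi) (K : ℤ) :
    |(Chebyshev.T ℝ K).eval ((hi + lo) / (hi - lo) - 2 / (hi - lo) * t)| ≤ 1 := by
  have hd : 0 < hi - lo := sub_pos.2 hlt
  refine Chebyshev.abs_eval_T_real_le_one K ?_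
  rw [div_mul_eq_mul_div, ← sub_div, abs_le, le_div_iff₀ hd, div_le_iff₀ hd]
  constructor <;> linarith [ht.1, ht.2]

lemma eval_chebPoly_mem_Icc (hlo : 0 < lo) (hK : √(hi / lo) ≤ K) {t : ℝ}
    (ht : t ∈ Set.Icc lo hi) : (chebPoly lo hi K).eval t ∈ Set.Icc (1 / 3) (5 / 3) := by
  rw [chebPoly]
  split_ifs with h
  · subst h
    rw [Set.Icc_self, Set.mem_singleton_iff] at ht
    rw [ht, eval_mul, eval_C, eval_X, one_div_mul_cancel hlo.ne']
    norm_num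
  · have hlt := (ht.1.trans ht.2).lt_of_ne h
    have hT := three_halves_le_eval_T_of_sqrt_le hlo hlt hK
    have hnum := abs_eval_T_rescale_le_one hlt ht K
    simp only [eval_sub, eval_one, eval_mul, eval_C, eval_comp, eval_X]
    set τ := eval ((hi + lo) / (hi - lo)) (Chebyshev.T ℝ (K : ℤ))
    set σ := eval ((hi + lo) / (hi - lo) - 2 / (hi - lo) * t) (Chebyshev.T ℝ (K : ℤ))
    have hquot : |1 / τ * σ| ≤ 2 / 3 := by
      rw [abs_mul, abs_of_nonneg (by positivity), one_div_mul_eq_div, div_le_iff₀ (by linarith)]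
      linarith
    rw [abs_le] at hquot
    constructor <;> linarith [hquot.1, hquot.2]

lemma natDegree_chebPoly_le (hK : 1 ≤ K) : (chebPoly lo hi K).natDegree ≤ K := by
  rw [chebPoly]
  split_ifs with h
  · exact (natDegree_C_mul_le _ _).trans (natDegree_X_le.trans hK)
  · have hlin : (C ((hi + lo) / (hi - lo)) - C (2 / (hi - lo)) * X).natDegree ≤ 1 := by
      compute_degree
    refine (natDegree_sub_le _ _).trans (max_le (natDegree_one.trans_le K.zero_le) ?_)
    refine (natDegree_C_mul_le _ _).trans (natDegree_comp_le.trans ?_)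
    rw [Chebyshev.natDegree_T, Int.natAbs_natCast]
    exact (Nat.mul_le_mul_left K hlin).trans_eq (mul_one K)

variable {n : Type} [Fintype n] [DecidableEq n] {M : Matrix n n ℝ}

namespace IsSingularPosSemidef

lemma eval_zero_chebFor (hM : IsSingularPosSemidef M) : (chebFor M).eval 0 = 0 :=
  eval_zero_chebPoly hM.lamMinPos_pos hM.lamMinPos_le_lamMax (Nat.le_ceil _)

lemma eval_chebFor_mem_Icc (hM : IsSingularPosSemidef M) {l : ℝ}
    (hl : l ∈ Set.Icc (lamMinPos M) (lamMax M)) :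
    (chebFor M).eval l ∈ Set.Icc (1 / 3) (5 / 3) :=
  eval_chebPoly_mem_Icc hM.lamMinPos_pos (Nat.le_ceil _) hl

lemma eval_chebFor_pos (hM : IsSingularPosSemidef M) {l : ℝ}
    (hl : l ∈ Set.Icc (lamMinPos M) (lamMax M)) : 0 < (chebFor M).eval l :=
  one_div_pos.2 three_pos |>.trans_le (hM.eval_chebFor_mem_Icc hl).1

lemma eval_chebFor_eq_zero_iff (hM : IsSingularPosSemidef M) {l : ℝ} (hl : l ∈ spectrum ℝ M) :
    (chebFor M).eval l = 0 ↔ l = 0 := by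
  refine ⟨fun h => ?_, ?_⟩
  · by_contra h₀
    exact (hM.eval_chebFor_pos (hM.mem_Icc_of_mem_spectrum hl h₀)).ne' h
  · rintro rfl
    exact hM.eval_zero_chebFor

lemma chebMat (hM : IsSingularPosSemidef M) : IsSingularPosSemidef (chebMat M) :=
  hM.aeval hM.eval_zero_chebFor fun _ => hM.eval_chebFor_pos

lemma chi_chebMat_le (hM : IsSingularPosSemidef M) : chi (GloballyDual.chebMat M) ≤ 5 :=
  (hM.chi_aeval_le hM.eval_zero_chebFor (by norm_num) fun _ => hM.eval_chebFor_mem_Icc).trans_eq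
    (by norm_num)

lemma natDegree_chebFor_le (hM : IsSingularPosSemidef M) :
    ((chebFor M).natDegree : ℝ) ≤ 2 * √(chi M) := by
  have hchi : 1 ≤ √(chi M) := Real.one_le_sqrt.2 hM.one_le_chi
  have hdeg : ((chebFor M).natDegree : ℝ) ≤ ⌈√(chi M)⌉₊ :=
    Nat.cast_le.2 (natDegree_chebPoly_le (Nat.one_le_ceil_iff.2 (by linarith)))
  linarith [Nat.ceil_lt_add_one (Real.sqrt_nonneg (chi M))]

end IsSingularPosSemidef

end Chebyshev

/-! ### The constrained problem -/

section Block

variable {m n : ℕ}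

/-- The block vector `col(x_1, …, x_m)`. -/
def col (x : Fin m → Vec (Fin n)) : Vec (Fin m × Fin n) :=
  WithLp.toLp 2 fun i => x i.1 i.2

/-- The linear map `x ↦ x_i`. -/
def blockLinear (i : Fin m) : Vec (Fin m × Fin n) →ₗ[ℝ] Vec (Fin n) where
  toFun x := block x i
  map_add' _ _ := rfl
  map_smul' _ _ := rfl

lemma inner_eq_sum_block (x y : Vec (Fin m × Fin n)) :
    ⟪x, y⟫ = ∑ i, ⟪block x i, block y i⟫ := by
  simp only [PiLp.inner_apply, Fintype.sum_prod_type, block]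

lemma sq_norm_eq_sum_block (x : Vec (Fin m × Fin n)) : ‖x‖ ^ 2 = ∑ i, ‖block x i‖ ^ 2 := by
  simp only [← real_inner_self_eq_norm_sq, inner_eq_sum_block x x]

variable {f : Fin m → Vec (Fin n) → ℝ} {L μ : ℝ}

lemma hasGradientAt_sum_block {g : Fin m → Vec (Fin n)} {x : Vec (Fin m × Fin n)}
    (hf : ∀ i, HasGradientAt (f i) (g i) (block x i)) :
    HasGradientAt (fun x => ∑ i, f i (block x i)) (col g) x := by
  have summand (i : Fin m) := HasFDerivAt.comp x (hf i).hasFDerivAt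
    (blockLinear i).toContinuousLinearMap.hasFDerivAt
  refine (HasFDerivAt.fun_sum (u := Finset.univ) fun i _ => summand i).congr_fderiv ?_
  ext v
  rw [sum_apply, InnerProductSpace.toDual_apply_apply, inner_eq_sum_block]
  rfl

lemma gradient_sum_block (hf : ∀ i, Differentiable ℝ (f i)) (x : Vec (Fin m × Fin n)) :
    ∇ (fun x => ∑ i, f i (block x i)) x = col fun i => ∇ (f i) (block x i) :=
  (hasGradientAt_sum_block fun i => (hf i _).hasGradientAt).gradient

theorem IsSmooth.sum_block (hf : ∀ i, IsSmooth L (f i)) :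
    IsSmooth L fun x : Vec (Fin m × Fin n) => ∑ i, f i (block x i) := by
  refine ⟨fun x => (hasGradientAt_sum_block fun i =>
    ((hf i).1 _).hasGradientAt).differentiableAt, fun x y => ?_⟩
  rw [gradient_sum_block (fun i => (hf i).1), inner_eq_sum_block, sq_norm_eq_sum_block,
    Finset.mul_sum, ← Finset.sum_add_distrib, ← Finset.sum_add_distrib]
  exact Finset.sum_le_sum fun i _ => (hf i).2 (block x i) (block y i)

theorem IsStronglyConvexOn.sum_block (hf : ∀ i, IsStronglyConvexOn Set.univ μ (f i)) :
    IsStronglyConvexOn Set.univ μ fun x : Vec (Fin m × Fin n) => ∑ i, f i (block x i) := by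
  refine ⟨fun x => (hasGradientAt_sum_block fun i =>
    ((hf i).1 _).hasGradientAt).differentiableAt, fun x _ y _ => ?_⟩
  rw [gradient_sum_block (fun i => (hf i).1), inner_eq_sum_block, sq_norm_eq_sum_block,
    Finset.mul_sum, ← Finset.sum_add_distrib, ← Finset.sum_add_distrib]
  exact Finset.sum_le_sum fun i _ => (hf i).2 (block x i) trivial (block y i) trivial

theorem block_dualOracle_sum_block (hf : ∀ i, IsStronglyConvexOn Set.univ μ (f i)) (hμ : 0 < μ)
    (q : Vec (Fin m × Fin n)) (i : Fin m) :
    block (dualOracle (fun x => ∑ i, f i (block x i)) q) i = dualOracle (f i) (block q i) := by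
  have hq := (IsStronglyConvexOn.sum_block hf).gradient_dualOracle hμ q
  rw [gradient_sum_block (fun i => (hf i).1)] at hq
  nth_rw 2 [← hq]
  exact ((hf i).dualOracle_gradient hμ _).symm

lemma block_kronecker_one (T : Matrix (Fin m) (Fin m) ℝ) (x : Vec (Fin m × Fin n)) (i : Fin m) :
    block ((T ⊗ₖ (1 : Matrix (Fin n) (Fin n) ℝ)).toEuclideanLin x) i =
      ∑ j, T i j • block x j := by
  ext k
  simp [block, Matrix.toEuclideanLin, Matrix.toLpLin_apply, Matrix.mulVec, dotProduct,
    Fintype.sum_prod_type, Matrix.one_apply]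

lemma block_one_kronecker {r : ℕ} (S : Matrix (Fin r) (Fin n) ℝ) (x : Vec (Fin m × Fin n))
    (i : Fin m) :
    block (((1 : Matrix (Fin m) (Fin m) ℝ) ⊗ₖ S).toEuclideanLin x) i =
      S.toEuclideanLin (block x i) := by
  ext j
  simp [block, Matrix.toEuclideanLin, Matrix.toLpLin_apply, Matrix.mulVec, dotProduct,
    Fintype.sum_prod_type, Matrix.one_apply, ite_mul, Finset.sum_ite_irrel]

end Block

namespace Problem

variable {m d p : ℕ} {P : Problem m d p} {γ : ℝ}

/-- The linear subspace cut out by the constraints `𝐖x = 0` and `𝐁x = 0`. -/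
def feasibleSubspace (P : Problem m d p) : Submodule ℝ (Vec (Fin m × Fin d)) :=
  LinearMap.ker P.bigW.toEuclideanLin ⊓ LinearMap.ker P.bigB.toEuclideanLin

lemma bigW_transpose (hW : P.W.IsHermitian) : P.bigW.transpose = P.bigW := by
  rw [bigW, ← Matrix.kroneckerMap_transpose, Matrix.transpose_one,
    show P.W.transpose = P.W from hW]

lemma bigB_transpose : P.bigB.transpose = (1 : Matrix (Fin m) (Fin m) ℝ) ⊗ₖ P.B.transpose := by
  rw [bigB, ← Matrix.kroneckerMap_transpose, Matrix.transpose_one]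

lemma bigB_transpose_mul_self :
    P.bigB.transpose * P.bigB = (1 : Matrix (Fin m) (Fin m) ℝ) ⊗ₖ P.BtB := by
  rw [bigB_transpose, bigB, ← Matrix.mul_kronecker_mul, one_mul, BtB]

lemma gram_eq_weightedGram (hW : P.W.IsHermitian) (γ : ℝ) :
    P.gram γ = weightedGram P.BtB P.W (γ ^ 2) := by
  rw [gram, A, Matrix.transpose_fromRows, Matrix.fromCols_mul_fromRows, bigB_transpose_mul_self,
    Matrix.transpose_smul, Matrix.smul_mul, Matrix.mul_smul, smul_smul, ← pow_two,
    bigW_transpose hW, bigW, ← Matrix.mul_kronecker_mul, one_mul, weightedGram]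

lemma transpose_A_toEuclideanLin (hW : P.W.IsHermitian) (γ : ℝ) (y : Vec (DualIdx m d p)) :
    (P.A γ).transpose.toEuclideanLin y =
      P.bigB.transpose.toEuclideanLin (WithLp.toLp 2 fun i => y (Sum.inl i)) +
        γ • P.bigW.toEuclideanLin (WithLp.toLp 2 fun i => y (Sum.inr i)) := by
  ext i
  simp [A, Matrix.toEuclideanLin, Matrix.toLpLin_apply, Matrix.transpose_fromRows,
    bigW_transpose hW, Matrix.fromCols_mulVec, Matrix.smul_mulVec, Function.comp_def]

lemma ker_one_kronecker_BtB :
    LinearMap.ker ((1 : Matrix (Fin m) (Fin m) ℝ) ⊗ₖ P.BtB).toEuclideanLin =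
      LinearMap.ker P.bigB.toEuclideanLin := by
  rw [← bigB_transpose_mul_self, ker_toEuclideanLin_transpose_mul_self]

/-- The properties of `H` on which the analysis of the globally dual method rests. -/
structure IsConstraintGram (P : Problem m d p)
    (H : Matrix (Fin m × Fin d) (Fin m × Fin d) ℝ) : Prop where
  posSemidef : H.PosSemidef
  ne_zero : H ≠ 0
  lamMinPos_lt_lamMax : lamMinPos H < lamMax H
  ker_eq : LinearMap.ker H.toEuclideanLin = P.feasibleSubspace

lemma isConstraintGram_weightedGram {G : Matrix (Fin d) (Fin d) ℝ}
    {V : Matrix (Fin m) (Fin m) ℝ} {c : ℝ}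
    (hG : IsSingularPosSemidef G) (hV : IsSingularPosSemidef V) (hc : 0 < c)
    (kerG : LinearMap.ker ((1 : Matrix (Fin m) (Fin m) ℝ) ⊗ₖ G).toEuclideanLin =
      LinearMap.ker P.bigB.toEuclideanLin)
    (kerV : LinearMap.ker (V ⊗ₖ (1 : Matrix (Fin d) (Fin d) ℝ)).toEuclideanLin =
      LinearMap.ker P.bigW.toEuclideanLin) :
    P.IsConstraintGram (weightedGram G V c) where
  posSemidef := weightedGram_posSemidef hG.posSemidef hV.posSemidef.isHermitian hc.le
  ne_zero := weightedGram_ne_zero hG hV hc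
  lamMinPos_lt_lamMax := lamMinPos_lt_lamMax_weightedGram hG hV hc
  ker_eq := by
    rw [ker_weightedGram hG.posSemidef hV.posSemidef.isHermitian hc, kerG, kerV, inf_comm,
      feasibleSubspace]

namespace Assumptions

lemma isSingularPosSemidef_W (hP : P.Assumptions) : IsSingularPosSemidef P.W where
  posSemidef := hP.posSemidef
  ne_zero h := by
    have := (hP.kernel (Pi.single ⟨0, by have := hP.two_le; omega⟩ 1)).1
      (by rw [h, Matrix.zero_mulVec]) ⟨0, by have := hP.two_le; omega⟩ ⟨1, hP.two_le⟩
    simp at this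
  zero_mem_spectrum := by
    refine spectrum.zero_mem ℝ fun h => ?_
    have := Matrix.mulVec_injective_iff_isUnit.2 h
      (((hP.kernel fun _ => 1).2 fun _ _ => rfl).trans (Matrix.mulVec_zero _).symm)
    exact one_ne_zero (congrFun this ⟨1, hP.two_le⟩)

lemma isSingularPosSemidef_BtB (hP : P.Assumptions) : IsSingularPosSemidef P.BtB where
  posSemidef := transpose_mul_self_posSemidef P.B
  ne_zero := by
    have h := (Matrix.conjTranspose_mul_self_eq_zero (A := P.B)).not.2 hP.B_ne_zero
    rwa [Matrix.conjTranspose_eq_transpose_of_trivial] at h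
  zero_mem_spectrum := by
    obtain ⟨x, hx, hBx⟩ := hP.ker_B
    refine spectrum.zero_mem ℝ fun h => hx (Matrix.mulVec_injective_iff_isUnit.2 h ?_)
    rw [BtB, ← Matrix.mulVec_mulVec, hBx, Matrix.mulVec_zero, Matrix.mulVec_zero]

lemma isConstraintGram_gram (hP : P.Assumptions) (hγ : 0 < γ) :
    P.IsConstraintGram (P.gram γ) := by
  rw [gram_eq_weightedGram hP.posSemidef.isHermitian]
  exact isConstraintGram_weightedGram hP.isSingularPosSemidef_BtB hP.isSingularPosSemidef_W
    (pow_pos hγ 2) ker_one_kronecker_BtB rfl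

lemma isConstraintGram_chebGram (hP : P.Assumptions) : P.IsConstraintGram P.chebGram := by
  have hG := hP.isSingularPosSemidef_BtB
  have hV := hP.isSingularPosSemidef_W
  have hG₀ := hG.chebMat.lamMinPos_pos
  have hV₀ := hV.chebMat.lamMinPos_pos
  refine isConstraintGram_weightedGram hG.chebMat hV.chebMat (by positivity) ?_ ?_
  · exact (ker_one_kronecker_aeval hG.posSemidef fun _ => hG.eval_chebFor_eq_zero_iff).trans
      ker_one_kronecker_BtB
  · exact ker_aeval_kronecker_one hV.posSemidef fun _ => hV.eval_chebFor_eq_zero_iff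

lemma chi_gram (hP : P.Assumptions) (hγ : 0 < γ) :
    chi (P.gram γ) = (lamMax P.BtB + γ ^ 2 * lamMax P.W ^ 2) /
      min (lamMinPos P.BtB) (γ ^ 2 * lamMinPos P.W ^ 2) := by
  rw [gram_eq_weightedGram hP.posSemidef.isHermitian]
  exact chi_weightedGram hP.isSingularPosSemidef_BtB hP.isSingularPosSemidef_W (pow_pos hγ 2)

lemma gammaOpt_pos (hP : P.Assumptions) : 0 < P.gammaOpt :=
  div_pos (Real.sqrt_pos.2 hP.isSingularPosSemidef_BtB.lamMinPos_pos)
    hP.isSingularPosSemidef_W.lamMinPos_pos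

lemma chi_gram_gammaOpt (hP : P.Assumptions) :
    chi (P.gram P.gammaOpt) = chi P.BtB + chi P.W ^ 2 := by
  rw [gram_eq_weightedGram hP.posSemidef.isHermitian, gammaOpt, div_pow,
    Real.sq_sqrt hP.isSingularPosSemidef_BtB.lamMinPos_pos.le]
  exact chi_weightedGram_opt hP.isSingularPosSemidef_BtB hP.isSingularPosSemidef_W

lemma chi_gram_gammaOpt_le (hP : P.Assumptions) (hγ : 0 < γ) :
    chi (P.gram P.gammaOpt) ≤ chi (P.gram γ) := by
  rw [hP.chi_gram_gammaOpt, gram_eq_weightedGram hP.posSemidef.isHermitian]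
  exact chi_add_sq_le_chi_weightedGram hP.isSingularPosSemidef_BtB hP.isSingularPosSemidef_W
    (pow_pos hγ 2)

lemma chi_chebGram_le (hP : P.Assumptions) : chi P.chebGram ≤ 30 := by
  have hG := hP.isSingularPosSemidef_BtB
  have hV := hP.isSingularPosSemidef_W
  calc chi P.chebGram = chi (chebMat P.BtB) + chi (chebMat P.W) ^ 2 :=
        chi_weightedGram_opt hG.chebMat hV.chebMat
    _ ≤ 5 + 5 ^ 2 := add_le_add hG.chi_chebMat_le
        (pow_le_pow_left₀ (zero_le_one.trans hV.chebMat.one_le_chi) hV.chi_chebMat_le 2)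
    _ = 30 := by norm_num

lemma μ_le_L (hP : P.Assumptions) : P.μ ≤ P.L := by
  obtain ⟨x, hx, -⟩ := hP.ker_B
  have : Nontrivial (Vec (Fin d)) := ⟨WithLp.toLp 2 x, 0, fun h => hx (congrArg WithLp.ofLp h)⟩
  exact (hP.smooth ⟨0, by have := hP.two_le; omega⟩).le_of_isStronglyConvexOn (hP.strong _)

end Assumptions

end Problem

namespace Problem

variable {m d p : ℕ} {P : Problem m d p} {γ : ℝ} {xs p₀ : Vec (Fin m × Fin d)}
  {H : Matrix (Fin m × Fin d) (Fin m × Fin d) ℝ}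

namespace IsConstraintGram

lemma lamMax_pos (hH : P.IsConstraintGram H) : 0 < lamMax H :=
  GloballyDual.lamMax_pos hH.posSemidef hH.ne_zero

lemma lamMinPos_pos (hH : P.IsConstraintGram H) : 0 < lamMinPos H :=
  GloballyDual.lamMinPos_pos hH.posSemidef hH.ne_zero

lemma range_transpose {k : Type} [Fintype k] [DecidableEq k] {R : Matrix k (Fin m × Fin d) ℝ}
    (hH : P.IsConstraintGram (R.transpose * R)) :
    LinearMap.range R.transpose.toEuclideanLin = P.feasibleSubspaceᗮ := by
  rw [range_transpose_toEuclideanLin, ← ker_toEuclideanLin_transpose_mul_self, hH.ker_eq]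

lemma toEuclideanLin_mem (hH : P.IsConstraintGram H) (x : Vec (Fin m × Fin d)) :
    H.toEuclideanLin x ∈ P.feasibleSubspaceᗮ := by
  have hHt : H.transpose = H := hH.posSemidef.isHermitian
  rw [← hH.ker_eq, ← range_transpose_toEuclideanLin, hHt]
  exact LinearMap.mem_range_self _ x

lemma globallyDual_mem (hH : P.IsConstraintGram H) (hp₀ : p₀ ∈ P.feasibleSubspaceᗮ) (k : ℕ) :
    P.globallyDual H p₀ k ∈ P.feasibleSubspaceᗮ := by
  have h := add_mem (accel_sub_mem (fun q => hH.toEuclideanLin_mem (dualOracle P.F q)) (P.step H)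
    (P.momentum H) p₀ k).1 hp₀
  rwa [sub_add_cancel] at h

end IsConstraintGram

namespace Assumptions

lemma L_pos (hP : P.Assumptions) : 0 < P.L := hP.μ_pos.trans_le hP.μ_le_L

lemma isStronglyConvexOn_F (hP : P.Assumptions) : IsStronglyConvexOn Set.univ P.μ P.F :=
  .sum_block hP.strong

lemma isSmooth_F (hP : P.Assumptions) : IsSmooth P.L P.F := .sum_block hP.smooth

lemma block_dualOracle (hP : P.Assumptions) (q : Vec (Fin m × Fin d)) (i : Fin m) :
    block (dualOracle P.F q) i = dualOracle (P.f i) (block q i) :=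
  block_dualOracle_sum_block hP.strong hP.μ_pos q i

lemma exists_isSolution (hP : P.Assumptions) : ∃ xs, P.IsSolution xs := by
  obtain ⟨x, hx, hmin⟩ := hP.isStronglyConvexOn_F.exists_isMinOn hP.μ_pos 0 P.feasibleSubspace
  simp only [inner_zero_left, sub_zero] at hmin
  exact ⟨x, hx, fun z hz => hmin hz⟩

lemma gradient_mem_orthogonal (hP : P.Assumptions) (hxs : P.IsSolution xs) :
    ∇ P.F xs ∈ P.feasibleSubspaceᗮ :=
  gradient_mem_orthogonal_of_isMinOn (hP.isSmooth_F.1 xs) hxs.1 fun z hz => hxs.2 z hz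

lemma conjugate_gradient_solution (hP : P.Assumptions) (hxs : P.IsSolution xs) :
    conjugate P.F (∇ P.F xs) = -P.F xs := by
  rw [hP.isStronglyConvexOn_F.conjugate_gradient hP.μ_pos.le,
    (Submodule.mem_orthogonal' _ _).1 (hP.gradient_mem_orthogonal hxs) xs hxs.1, zero_sub]

end Assumptions

lemma neg_F_add_inner (γ : ℝ) (y : Vec (DualIdx m d p)) :
    (fun x => -P.F x + ⟪y, (P.A γ).toEuclideanLin x⟫) =
      fun x => ⟪(P.A γ).transpose.toEuclideanLin y, x⟫ - P.F x := by
  ext x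
  rw [inner_toEuclideanLin_comm, neg_add_eq_sub]

lemma Phi_eq_conjugate (γ : ℝ) (y : Vec (DualIdx m d p)) :
    P.Phi γ y = conjugate P.F ((P.A γ).transpose.toEuclideanLin y) := by
  rw [Phi, conjugate, neg_F_add_inner]

lemma ker_A (hP : P.Assumptions) (hγ : 0 < γ) :
    LinearMap.ker (P.A γ).toEuclideanLin = P.feasibleSubspace :=
  (ker_toEuclideanLin_transpose_mul_self (P.A γ)).symm.trans (hP.isConstraintGram_gram hγ).ker_eq

namespace Assumptions

lemma isGreatest_Phi (hP : P.Assumptions) (γ : ℝ) (y : Vec (DualIdx m d p)) :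
    IsGreatest (Set.range fun x => -P.F x + ⟪y, (P.A γ).toEuclideanLin x⟫) (P.Phi γ y) := by
  obtain ⟨z, hz⟩ := hP.isStronglyConvexOn_F.exists_gradient_eq hP.μ_pos
    ((P.A γ).transpose.toEuclideanLin y)
  rw [neg_F_add_inner, Phi_eq_conjugate, ← hz,
    hP.isStronglyConvexOn_F.conjugate_gradient hP.μ_pos.le]
  exact hP.isStronglyConvexOn_F.isGreatest_conjugate hP.μ_pos.le z

lemma hasGradientAt_Phi (hP : P.Assumptions) (γ : ℝ) (y : Vec (DualIdx m d p)) :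
    HasGradientAt (P.Phi γ)
      ((P.A γ).toEuclideanLin (dualOracle P.F ((P.A γ).transpose.toEuclideanLin y))) y := by
  have h := hasGradientAt_comp_clm (S := (P.A γ).transpose.toEuclideanLin.toContinuousLinearMap)
    ((hP.isStronglyConvexOn_F.isSmooth_conjugate hP.μ_pos).1 _).hasGradientAt (y := y)
  rwa [adjoint_toEuclideanLin, Matrix.transpose_transpose, LinearMap.coe_toContinuousLinearMap',
    LinearMap.coe_toContinuousLinearMap', ← funext (Phi_eq_conjugate γ)] at h

lemma isSmooth_Phi (hP : P.Assumptions) (hγ : 0 < γ) :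
    IsSmooth (lamMax (P.gram γ) / P.μ) (P.Phi γ) := by
  rw [funext (Phi_eq_conjugate γ), div_eq_mul_inv]
  refine (hP.isStronglyConvexOn_F.isSmooth_conjugate hP.μ_pos).comp_clm
    (S := (P.A γ).transpose.toEuclideanLin.toContinuousLinearMap) (inv_pos.2 hP.μ_pos).le ?_
  rw [← adjoint_toEuclideanLin, LinearIsometryEquiv.norm_map]
  exact sq_norm_toEuclideanLin_le (hP.isConstraintGram_gram hγ).ne_zero

lemma isStronglyConvexOn_Phi (hP : P.Assumptions) (hγ : 0 < γ) :
    IsStronglyConvexOn ((LinearMap.ker (P.A γ).transpose.toEuclideanLin)ᗮ : Set _)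
      (lamMinPos (P.gram γ) / P.L) (P.Phi γ) := by
  rw [funext (Phi_eq_conjugate γ), div_eq_mul_inv]
  refine (hP.isStronglyConvexOn_F.isStronglyConvexOn_conjugate hP.μ_pos hP.L_pos
    hP.isSmooth_F).comp_clm (S := (P.A γ).transpose.toEuclideanLin.toContinuousLinearMap)
    (inv_pos.2 hP.L_pos).le fun x hx y hy => ?_
  exact lamMinPos_mul_sq_norm_le (hP.isConstraintGram_gram hγ).ne_zero (Submodule.sub_mem _ hy hx)

lemma step_pos (hP : P.Assumptions) (hH : P.IsConstraintGram H) : 0 < P.step H :=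
  one_div_pos.2 (div_pos hH.lamMax_pos hP.μ_pos)

lemma dualMu_pos (hP : P.Assumptions) (hH : P.IsConstraintGram H) : 0 < P.dualMu H :=
  div_pos hH.lamMinPos_pos hP.L_pos

lemma dualMu_lt_dualL (hP : P.Assumptions) (hH : P.IsConstraintGram H) :
    P.dualMu H < P.dualL H :=
  calc lamMinPos H / P.L ≤ lamMinPos H / P.μ :=
        div_le_div_of_nonneg_left hH.lamMinPos_pos.le hP.μ_pos hP.μ_le_L
    _ < lamMax H / P.μ := div_lt_div_of_pos_right hH.lamMinPos_lt_lamMax hP.μ_pos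

lemma momentum_pos (hP : P.Assumptions) (hH : P.IsConstraintGram H) : 0 < P.momentum H :=
  div_pos (sub_pos.2 (Real.sqrt_lt_sqrt (hP.dualMu_pos hH).le (hP.dualMu_lt_dualL hH)))
    (add_pos_of_nonneg_of_pos (Real.sqrt_nonneg _) (Real.sqrt_pos.2 (hP.dualMu_pos hH)))

lemma momentum_lt_one (hP : P.Assumptions) (hH : P.IsConstraintGram H) : P.momentum H < 1 := by
  have := Real.sqrt_pos.2 (hP.dualMu_pos hH)
  have := Real.sqrt_nonneg (P.dualL H)
  rw [momentum, div_lt_one (by positivity)]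
  linarith

end Assumptions

/-- The quantity `r` in the factor `D`: by strong convexity, the distance from `x(p₀)` to the
solution `xs` is at most `r`. -/
def radius (P : Problem m d p) (p₀ xs : Vec (Fin m × Fin d)) : ℝ := ‖p₀ - ∇ P.F xs‖ / P.μ

namespace Assumptions

lemma conjugate_globallyDual_sub_le (hP : P.Assumptions) (hH : P.IsConstraintGram H)
    (hxs : P.IsSolution xs) (hp₀ : p₀ ∈ P.feasibleSubspaceᗮ) (k : ℕ) :
    conjugate P.F (P.globallyDual H p₀ k) - conjugate P.F (∇ P.F xs) ≤
      (1 - √(P.dualMu H / P.dualL H)) ^ k * (P.μ * P.radius p₀ xs ^ 2) := by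
  obtain ⟨R, rfl⟩ := exists_eq_transpose_mul_self hH.posSemidef
  have adjoint_eq := adjoint_toEuclideanLin R.transpose
  rw [Matrix.transpose_transpose] at adjoint_eq
  have rate := conjugate_accel_sub_le (p₀ := p₀) (xs := xs) (a := lamMax (R.transpose * R))
    (b := lamMinPos (R.transpose * R)) (S := R.transpose.toEuclideanLin.toContinuousLinearMap)
    hP.isStronglyConvexOn_F hP.μ_pos hP.isSmooth_F hP.μ_le_L
    (by rw [← adjoint_toEuclideanLin, LinearIsometryEquiv.norm_map]
        exact sq_norm_toEuclideanLin_le hH.ne_zero)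
    hH.lamMinPos_pos hH.lamMinPos_lt_lamMax.le
    (fun y hy => lamMinPos_mul_sq_norm_le hH.ne_zero hy) (hH.range_transpose.ge hp₀)
    (by rw [adjoint_eq]
        exact (ker_toEuclideanLin_transpose_mul_self R).le (hH.ker_eq.ge hxs.1))
    (hH.range_transpose.ge (hP.gradient_mem_orthogonal hxs)) k
  have gradient_map : (fun q => (R.transpose * R).toEuclideanLin (dualOracle P.F q)) = fun q =>
      R.transpose.toEuclideanLin.toContinuousLinearMap
        (R.transpose.toEuclideanLin.toContinuousLinearMap.adjoint (dualOracle P.F q)) := by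
    rw [adjoint_eq, Matrix.toEuclideanLin, Matrix.toLpLin_mul_same]
    rfl
  have initial_gap : P.μ⁻¹ * ‖p₀ - ∇ P.F xs‖ ^ 2 = P.μ * P.radius p₀ xs ^ 2 := by
    have := hP.μ_pos
    rw [radius]
    field
  rwa [← gradient_map, initial_gap] at rate

lemma sqrt_dualMu_div_dualL (hP : P.Assumptions)
    (H : Matrix (Fin m × Fin d) (Fin m × Fin d) ℝ) :
    √(P.dualMu H / P.dualL H) = (√(P.L / P.μ) * √(chi H))⁻¹ := by
  rw [dualMu, dualL, chi, ← Real.sqrt_mul (div_pos hP.L_pos hP.μ_pos).le, ← Real.sqrt_inv,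
    div_div_div_eq, mul_inv, inv_div, inv_div, div_mul_div_comm, mul_comm (lamMinPos H)]

lemma rate_pow_le (hP : P.Assumptions) (hH : P.IsConstraintGram H) {t : ℝ} {k : ℕ}
    (hk : √(P.L / P.μ) * √(chi H) * t ≤ k) :
    (1 - √(P.dualMu H / P.dualL H)) ^ k ≤ Real.exp (-t) := by
  have ratio_lt : P.dualMu H / P.dualL H < 1 :=
    (div_lt_one ((hP.dualMu_pos hH).trans (hP.dualMu_lt_dualL hH))).2 (hP.dualMu_lt_dualL hH)
  have cond_pos : 0 < √(P.L / P.μ) * √(chi H) :=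
    mul_pos (Real.sqrt_pos.2 (div_pos hP.L_pos hP.μ_pos))
      (Real.sqrt_pos.2 (div_pos hH.lamMax_pos hH.lamMinPos_pos))
  have ht : t ≤ k * √(P.dualMu H / P.dualL H) := by
    rwa [hP.sqrt_dualMu_div_dualL, ← div_eq_mul_inv, le_div_iff₀' cond_pos]
  calc (1 - √(P.dualMu H / P.dualL H)) ^ k ≤ Real.exp (-√(P.dualMu H / P.dualL H)) ^ k :=
        pow_le_pow_left₀ (sub_nonneg.2 (Real.sqrt_le_one.2 ratio_lt.le))
          (Real.one_sub_le_exp_neg _) k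
    _ = Real.exp (-(k * √(P.dualMu H / P.dualL H))) := by rw [← Real.exp_nat_mul, mul_neg]
    _ ≤ Real.exp (-t) := Real.exp_le_exp.2 (neg_le_neg ht)

end Assumptions

end Problem

namespace Problem

variable {m d p : ℕ} {P : Problem m d p} {γ ε e : ℝ} {x xs q p₀ : Vec (Fin m × Fin d)}
  {H : Matrix (Fin m × Fin d) (Fin m × Fin d) ℝ}

lemma scale_eq (P : Problem m d p) (γ : ℝ) (p₀ xs : Vec (Fin m × Fin d)) :
    P.scale γ p₀ xs = 3 + √(lamMax (P.gram γ)) * P.radius p₀ xs +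
      ‖∇ P.F xs‖ * P.radius p₀ xs + P.L * P.radius p₀ xs ^ 2 := rfl

namespace Assumptions

lemma radius_nonneg (hP : P.Assumptions) (p₀ xs : Vec (Fin m × Fin d)) : 0 ≤ P.radius p₀ xs :=
  div_nonneg (norm_nonneg _) hP.μ_pos.le

lemma three_le_scale (hP : P.Assumptions) (γ : ℝ) (p₀ xs : Vec (Fin m × Fin d)) :
    3 ≤ P.scale γ p₀ xs := by
  have := hP.radius_nonneg p₀ xs
  have := hP.L_pos
  rw [scale_eq, add_assoc, add_assoc]
  exact le_add_of_nonneg_right (by positivity)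

lemma mu_mul_sq_radius_le_scale (hP : P.Assumptions) (γ : ℝ) (p₀ xs : Vec (Fin m × Fin d)) :
    P.μ * P.radius p₀ xs ^ 2 ≤ P.scale γ p₀ xs := by
  have := hP.radius_nonneg p₀ xs
  refine (mul_le_mul_of_nonneg_right hP.μ_le_L (by positivity)).trans ?_
  rw [scale_eq]
  exact le_add_of_nonneg_left (by positivity)

lemma one_le_log_scale (hP : P.Assumptions) (γ : ℝ) (p₀ xs : Vec (Fin m × Fin d)) (hε : 0 < ε)
    (hε₁ : ε < 1) : 1 ≤ Real.log (P.scale γ p₀ xs / ε) := by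
  have three_le : 3 ≤ P.scale γ p₀ xs / ε :=
    (hP.three_le_scale γ p₀ xs).trans <|
      le_div_self (by linarith [hP.three_le_scale γ p₀ xs]) hε hε₁.le
  rw [Real.le_log_iff_exp_le (by linarith)]
  linarith [Real.exp_one_lt_d9]

lemma one_le_sqrt_L_div_mu (hP : P.Assumptions) : 1 ≤ √(P.L / P.μ) :=
  Real.one_le_sqrt.2 ((one_le_div hP.μ_pos).2 hP.μ_le_L)

lemma norm_dualOracle_sub_le (hP : P.Assumptions) (hxs : P.IsSolution xs)
    (hq : q ∈ P.feasibleSubspaceᗮ) {r : ℝ} (he : 0 ≤ e) (hr : 0 ≤ r)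
    (hgap : conjugate P.F q - conjugate P.F (∇ P.F xs) ≤ e ^ 2 / 2 * (P.μ * r ^ 2)) :
    ‖dualOracle P.F q - xs‖ ≤ e * r := by
  have gap_ge := hP.isStronglyConvexOn_F.norm_dualOracle_sub_sq_le hP.μ_pos q xs
  rw [(Submodule.mem_orthogonal' _ _).1 hq xs hxs.1] at gap_ge
  rw [hP.conjugate_gradient_solution hxs] at hgap
  refine le_of_sq_le_sq ?_ (mul_nonneg he hr)
  refine le_of_mul_le_mul_left ?_ (half_pos hP.μ_pos)
  linarith

lemma epsSolution_of_norm_sub_le (hP : P.Assumptions) (hxs : P.IsSolution xs) (hγ : 0 < γ)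
    (he : 0 ≤ e) (he₁ : e ≤ 1) (hx : ‖x - xs‖ ≤ e * P.radius p₀ xs) :
    P.EpsSolution γ (e * P.scale γ p₀ xs) x := by
  set r := P.radius p₀ xs
  have hr : 0 ≤ r := hP.radius_nonneg p₀ xs
  have hL := hP.L_pos
  constructor
  · intro z hz
    calc P.F x - P.F z ≤ P.F x - P.F xs := sub_le_sub_left (hxs.2 z hz) _
      _ ≤ ‖∇ P.F xs‖ * ‖x - xs‖ + P.L / 2 * ‖x - xs‖ ^ 2 := hP.isSmooth_F.sub_le xs x
      _ ≤ ‖∇ P.F xs‖ * (e * r) + P.L * (e * r) ^ 2 := by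
          gcongr
          exact half_le_self hL.le
      _ = e * (‖∇ P.F xs‖ * r + e * (P.L * r ^ 2)) := by ring
      _ ≤ e * (‖∇ P.F xs‖ * r + 1 * (P.L * r ^ 2)) := by gcongr
      _ ≤ e * P.scale γ p₀ xs := by
          refine mul_le_mul_of_nonneg_left ?_ he
          rw [scale_eq, one_mul, add_assoc]
          exact le_add_of_nonneg_left (by positivity)
  · have hA : (P.A γ).toEuclideanLin xs = 0 := (ker_A hP hγ).ge hxs.1
    have norm_A_le : ‖(P.A γ).toEuclideanLin.toContinuousLinearMap‖ ≤ √(lamMax (P.gram γ)) :=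
      Real.le_sqrt_of_sq_le (sq_norm_toEuclideanLin_le (hP.isConstraintGram_gram hγ).ne_zero)
    calc ‖(P.A γ).toEuclideanLin x‖ = ‖(P.A γ).toEuclideanLin.toContinuousLinearMap (x - xs)‖ := by
          rw [LinearMap.coe_toContinuousLinearMap', map_sub, hA, sub_zero]
      _ ≤ √(lamMax (P.gram γ)) * (e * r) := ContinuousLinearMap.le_of_opNorm_le_of_le _ norm_A_le hx
      _ = e * (√(lamMax (P.gram γ)) * r) := by ring
      _ ≤ e * P.scale γ p₀ xs := by
          refine mul_le_mul_of_nonneg_left ?_ he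
          have : 0 ≤ 3 + ‖∇ P.F xs‖ * r + P.L * r ^ 2 := by positivity
          linarith [P.scale_eq γ p₀ xs]

lemma epsSolution_globallyDual (hP : P.Assumptions) (hH : P.IsConstraintGram H)
    (hxs : P.IsSolution xs) (hp₀ : p₀ ∈ P.feasibleSubspaceᗮ) (hγ : 0 < γ) (hε : 0 < ε)
    (hε₁ : ε < 1) {k : ℕ}
    (hk : √(P.L / P.μ) * √(chi H) * (3 * Real.log (P.scale γ p₀ xs / ε)) ≤ k) :
    P.EpsSolution γ ε (dualOracle P.F (P.globallyDual H p₀ k)) := by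
  have := hP.μ_pos
  have three_le := hP.three_le_scale γ p₀ xs
  set e := ε / P.scale γ p₀ xs with he_def
  have he : 0 < e := by positivity
  have he₂ : e ≤ 1 / 2 := by
    rw [div_le_iff₀ (by linarith)]
    linarith
  have hexp : Real.exp (-(3 * Real.log (P.scale γ p₀ xs / ε))) = e ^ 3 := by
    rw [← mul_neg, ← Real.log_inv, inv_div, mul_comm, Real.exp_mul, Real.exp_log he]
    norm_cast
  have gap_le : conjugate P.F (P.globallyDual H p₀ k) - conjugate P.F (∇ P.F xs) ≤
      e ^ 2 / 2 * (P.μ * P.radius p₀ xs ^ 2) :=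
    calc _ ≤ _ := hP.conjugate_globallyDual_sub_le hH hxs hp₀ k
      _ ≤ e ^ 2 * e * (P.μ * P.radius p₀ xs ^ 2) := by
          gcongr
          exact (hP.rate_pow_le hH hk).trans_eq (hexp.trans (pow_succ e 2))
      _ ≤ e ^ 2 / 2 * (P.μ * P.radius p₀ xs ^ 2) := by
          rw [div_eq_mul_one_div (e ^ 2)]
          gcongr
  have close := hP.norm_dualOracle_sub_le hxs (hH.globallyDual_mem hp₀ k) he.le
    (hP.radius_nonneg p₀ xs) gap_le
  have heps := hP.epsSolution_of_norm_sub_le hxs hγ he.le (he₂.trans (by norm_num)) close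
  rwa [he_def, div_mul_cancel₀ _ (by linarith)] at heps

lemma transpose_A_fastDual (hP : P.Assumptions) (γ : ℝ) (y₀ : Vec (DualIdx m d p)) (k : ℕ) :
    (P.A γ).transpose.toEuclideanLin (P.fastDual γ y₀ k) =
      P.globallyDual (P.gram γ) ((P.A γ).transpose.toEuclideanLin y₀) k := by
  refine congrArg Prod.fst (map_accel _ (fun y => ?_) _ _ y₀ k)
  rw [(hP.hasGradientAt_Phi γ y).gradient, gram, Matrix.toEuclideanLin, Matrix.toLpLin_mul_same,
    LinearMap.comp_apply]

lemma transpose_A_mem (hP : P.Assumptions) (hγ : 0 < γ) (y : Vec (DualIdx m d p)) :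
    (P.A γ).transpose.toEuclideanLin y ∈ P.feasibleSubspaceᗮ := by
  rw [← (hP.isConstraintGram_gram hγ).range_transpose]
  exact LinearMap.mem_range_self _ y

lemma fastDual_gap_le (hP : P.Assumptions) (hγ : 0 < γ) (hxs : P.IsSolution xs)
    (y₀ : Vec (DualIdx m d p)) (hε : 0 < ε) {k : ℕ}
    (hk : √(P.L / P.μ) * √(chi (P.gram γ)) *
      Real.log (P.scale γ ((P.A γ).transpose.toEuclideanLin y₀) xs / ε) ≤ k)
    (y : Vec (DualIdx m d p)) : P.Phi γ (P.fastDual γ y₀ k) - P.Phi γ y ≤ ε := by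
  set p₀ := (P.A γ).transpose.toEuclideanLin y₀
  have three_le := hP.three_le_scale γ p₀ xs
  have Phi_ge : -P.F xs ≤ P.Phi γ y := by
    have h := hP.isStronglyConvexOn_F.le_conjugate hP.μ_pos
      ((P.A γ).transpose.toEuclideanLin y) xs
    rwa [(Submodule.mem_orthogonal' _ _).1 (hP.transpose_A_mem hγ y) xs hxs.1, zero_sub,
      ← Phi_eq_conjugate] at h
  have rate_le := hP.rate_pow_le (hP.isConstraintGram_gram hγ) hk
  rw [Real.exp_neg, Real.exp_log (by positivity), inv_div] at rate_le
  have hμ := hP.μ_pos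
  calc P.Phi γ (P.fastDual γ y₀ k) - P.Phi γ y
      ≤ P.Phi γ (P.fastDual γ y₀ k) - -P.F xs := sub_le_sub_left Phi_ge _
    _ = conjugate P.F (P.globallyDual (P.gram γ) p₀ k) - conjugate P.F (∇ P.F xs) := by
        rw [hP.conjugate_gradient_solution hxs, Phi_eq_conjugate, hP.transpose_A_fastDual]
    _ ≤ _ := hP.conjugate_globallyDual_sub_le (hP.isConstraintGram_gram hγ) hxs
        (hP.transpose_A_mem hγ y₀) k
    _ ≤ ε / P.scale γ p₀ xs * P.scale γ p₀ xs :=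
        mul_le_mul rate_le (hP.mu_mul_sq_radius_le_scale γ p₀ xs) (by positivity) (by positivity)
    _ = ε := div_mul_cancel₀ _ (by linarith)

end Assumptions

end Problem

/-! ### Running the methods on the network -/

section Cost

variable {m d p : ℕ}

instance : Preorder (Memory m d p) := Preorder.lift fun s => (s.primal, s.aux)

variable {P : Problem m d p} {s₀ s s' : Memory m d p} {a c b a' c' b' : ℕ}

namespace Run

lemma le (h : Run P s₀ s a c b) : s₀ ≤ s := by
  induction h with
  | init => exact le_rfl
  | oracle _ _ _ ih | comm _ _ _ ih | mulBT _ _ _ ih =>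
    exact ih.trans ⟨fun _ => le_sup_left, le_rfl⟩
  | mulB _ _ _ ih => exact ih.trans ⟨le_rfl, fun _ => le_sup_left⟩

lemma trans (h : Run P s₀ s a c b) (h' : Run P s s' a' c' b') :
    Run P s₀ s' (a + a') (c + c') (b + b') := by
  induction h' with
  | init => exact h
  | oracle _ u hu ih => exact ih.oracle u hu
  | comm _ u hu ih => exact ih.comm u hu
  | mulB _ u hu ih => exact ih.mulB u hu
  | mulBT _ t ht ih => exact ih.mulBT t ht

end Run

/-- The vectors `x = col(x_1, …, x_m)` with `x_i ∈ S i`. -/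
def blockwise {n : ℕ} (S : Fin m → Submodule ℝ (Vec (Fin n))) :
    Submodule ℝ (Vec (Fin m × Fin n)) :=
  ⨅ i, (S i).comap (blockLinear i)

lemma mem_blockwise {n : ℕ} {S : Fin m → Submodule ℝ (Vec (Fin n))} {x : Vec (Fin m × Fin n)} :
    x ∈ blockwise S ↔ ∀ i, block x i ∈ S i :=
  Submodule.mem_iInf _

lemma blockwise_mono {n : ℕ} : Monotone (blockwise (m := m) (n := n)) :=
  fun _ _ h => iInf_mono fun i => Submodule.comap_mono (h i)

/-- The vectors of `ℝ^{md}` whose `i`-th block is stored at node `i`, for every `i`. -/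
def primalStored : Memory m d p →o Submodule ℝ (Vec (Fin m × Fin d)) where
  toFun s := blockwise s.primal
  monotone' _ _ h := blockwise_mono h.1

/-- The vectors of `ℝ^{mp}` whose `i`-th block is stored at node `i`, for every `i`. -/
def auxStored : Memory m d p →o Submodule ℝ (Vec (Fin m × Fin p)) where
  toFun s := blockwise s.aux
  monotone' _ _ h := blockwise_mono h.2

/-- The dual vectors `y = (u, v)` of which node `i` stores the `i`-th blocks of `u` and `v`, for
every `i`. -/
def dualStored : Memory m d p →o Submodule ℝ (Vec (Problem.DualIdx m d p)) where
  toFun s :=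
    { carrier := {y | WithLp.toLp 2 (fun i => y (Sum.inr i)) ∈ primalStored s ∧
        WithLp.toLp 2 (fun i => y (Sum.inl i)) ∈ auxStored s}
      add_mem' := fun hx hy => ⟨add_mem hx.1 hy.1, add_mem hx.2 hy.2⟩
      zero_mem' := ⟨zero_mem (primalStored s), zero_mem (auxStored s)⟩
      smul_mem' := fun r _ hx =>
        ⟨Submodule.smul_mem _ r hx.1, Submodule.smul_mem _ r hx.2⟩ }
  monotone' _ _ h _ hy := ⟨primalStored.mono h hy.1, auxStored.mono h hy.2⟩

lemma mem_primalStored_primalMemory (p₀ : Vec (Fin m × Fin d)) :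
    p₀ ∈ primalStored (primalMemory p p₀) :=
  mem_blockwise.2 fun _ => Submodule.mem_span_singleton_self _

lemma mem_dualStored_dualMemory (y₀ : Vec (Problem.DualIdx m d p)) :
    y₀ ∈ dualStored (dualMemory y₀) :=
  ⟨mem_blockwise.2 fun _ => Submodule.mem_span_singleton_self _,
    mem_blockwise.2 fun _ => Submodule.mem_span_singleton_self _⟩

section Evaluates

variable {V V' V'' : Type} [AddCommGroup V] [Module ℝ V] [AddCommGroup V'] [Module ℝ V']
  [AddCommGroup V''] [Module ℝ V'']

/-- From any memory in which `x` is stored in the sense of `K`, the network can reach, with `a`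
dual oracle calls, `c` communications and `b` multiplications by `B` or `Bᵀ`, a memory in which
`T x` is stored in the sense of `K'`. -/
def Evaluates (P : Problem m d p) (K : Memory m d p →o Submodule ℝ V)
    (K' : Memory m d p →o Submodule ℝ V') (T : V → V') (a c b : ℕ) : Prop :=
  ∀ s, ∀ x ∈ K s, ∃ s', Run P s s' a c b ∧ T x ∈ K' s'

namespace Evaluates

variable {K : Memory m d p →o Submodule ℝ V} {K' : Memory m d p →o Submodule ℝ V'}
  {K'' : Memory m d p →o Submodule ℝ V''}

lemma const_smul_id (r : ℝ) : Evaluates P K K (r • id) 0 0 0 :=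
  fun s _ hx => ⟨s, .init, Submodule.smul_mem _ r hx⟩

lemma comp {T' : V' → V''} {T : V → V'} (h' : Evaluates P K' K'' T' a' c' b')
    (h : Evaluates P K K' T a c b) :
    Evaluates P K K'' (T' ∘ T) (a + a') (c + c') (b + b') := by
  intro s x hx
  obtain ⟨s₁, hs₁, hTx⟩ := h s x hx
  obtain ⟨s₂, hs₂, hT'Tx⟩ := h' s₁ (T x) hTx
  exact ⟨s₂, hs₁.trans hs₂, hT'Tx⟩

lemma add {T T' : V → V'} (h : Evaluates P K K' T a c b) (h' : Evaluates P K K' T' a' c' b') :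
    Evaluates P K K' (T + T') (a + a') (c + c') (b + b') := by
  intro s x hx
  obtain ⟨s₁, hs₁, hTx⟩ := h s x hx
  obtain ⟨s₂, hs₂, hT'x⟩ := h' s₁ x (K.mono hs₁.le hx)
  exact ⟨s₂, hs₁.trans hs₂, add_mem (K'.mono hs₂.le hTx) hT'x⟩

lemma const_smul {T : V → V'} (h : Evaluates P K K' T a c b) (r : ℝ) :
    Evaluates P K K' (r • T) a c b := by
  intro s x hx
  obtain ⟨s₁, hs₁, hTx⟩ := h s x hx
  exact ⟨s₁, hs₁, Submodule.smul_mem _ r hTx⟩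

/-- Horner's scheme. -/
lemma aeval_of_natDegree_le {T : Module.End ℝ V} (h : Evaluates P K K T a c b) {n : ℕ}
    {q : Polynomial ℝ} (hq : q.natDegree ≤ n) :
    Evaluates P K K (Polynomial.aeval T q) (n * a) (n * c) (n * b) := by
  induction n generalizing q with
  | zero =>
    rw [Polynomial.eq_C_of_natDegree_le_zero hq, Polynomial.aeval_C, zero_mul, zero_mul, zero_mul]
    exact const_smul_id (q.coeff 0)
  | succ n ih =>
    have divX : q.divX.natDegree ≤ n := by
      rw [Polynomial.natDegree_divX_eq_natDegree_tsub_one]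
      omega
    have horner : ⇑(Polynomial.aeval T q) =
        Polynomial.aeval T q.divX ∘ T + q.coeff 0 • id := by
      conv_lhs => rw [← Polynomial.divX_mul_X_add q, map_add, map_mul, Polynomial.aeval_X,
        Polynomial.aeval_C]
      rfl
    rw [horner]
    convert ((ih divX).comp h).add (const_smul_id (q.coeff 0)) using 1 <;> ring

lemma toEuclideanLin_aeval {n : Type} [Fintype n] [DecidableEq n]
    {K : Memory m d p →o Submodule ℝ (Vec n)} {M : Matrix n n ℝ}
    (h : Evaluates P K K M.toEuclideanLin a c b) (q : Polynomial ℝ) :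
    Evaluates P K K (Polynomial.aeval M q).toEuclideanLin
      (q.natDegree * a) (q.natDegree * c) (q.natDegree * b) := by
  have aeval_toEuclideanLin := Polynomial.aeval_algHom_apply (Matrix.toLpLinAlgEquiv (R := ℝ) 2) M q
  have := h.aeval_of_natDegree_le (le_refl q.natDegree)
  exact aeval_toEuclideanLin ▸ this

end Evaluates

end Evaluates

namespace Problem

lemma toLp_A_toEuclideanLin_inl (γ : ℝ) (x : Vec (Fin m × Fin d)) :
    WithLp.toLp 2 (fun i => (P.A γ).toEuclideanLin x (Sum.inl i)) =
      P.bigB.toEuclideanLin x := by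
  ext i
  simp [A, Matrix.toEuclideanLin, Matrix.toLpLin_apply, Matrix.fromRows_mulVec]

lemma toLp_A_toEuclideanLin_inr (γ : ℝ) (x : Vec (Fin m × Fin d)) :
    WithLp.toLp 2 (fun i => (P.A γ).toEuclideanLin x (Sum.inr i)) =
      γ • P.bigW.toEuclideanLin x := by
  ext i
  simp [A, Matrix.toEuclideanLin, Matrix.toLpLin_apply, Matrix.fromRows_mulVec,
    Matrix.smul_mulVec]

lemma evaluates_bigB : Evaluates P primalStored auxStored P.bigB.toEuclideanLin 0 0 1 := by
  refine fun s x hx =>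
    ⟨_, Run.init.mulB (block x) (mem_blockwise.1 hx), mem_blockwise.2 fun i => ?_⟩
  rw [bigB, block_one_kronecker]
  exact Submodule.mem_sup_right (Submodule.mem_span_singleton_self _)

lemma evaluates_bigB_transpose :
    Evaluates P auxStored primalStored P.bigB.transpose.toEuclideanLin 0 0 1 := by
  refine fun s t ht =>
    ⟨_, Run.init.mulBT (block t) (mem_blockwise.1 ht), mem_blockwise.2 fun i => ?_⟩
  rw [bigB_transpose, block_one_kronecker]
  exact Submodule.mem_sup_right (Submodule.mem_span_singleton_self _)

lemma evaluates_one_kronecker_BtB :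
    Evaluates P primalStored primalStored
      ((1 : Matrix (Fin m) (Fin m) ℝ) ⊗ₖ P.BtB).toEuclideanLin 0 0 2 := by
  rw [← bigB_transpose_mul_self, Matrix.toEuclideanLin, Matrix.toLpLin_mul (q := 2)]
  exact evaluates_bigB_transpose.comp evaluates_bigB

lemma evaluates_chebMat_BtB :
    Evaluates P primalStored primalStored
      ((1 : Matrix (Fin m) (Fin m) ℝ) ⊗ₖ chebMat P.BtB).toEuclideanLin
      0 0 (2 * (chebFor P.BtB).natDegree) := by
  rw [chebMat, one_kronecker_aeval, mul_comm 2]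
  simpa only [mul_zero] using evaluates_one_kronecker_BtB.toEuclideanLin_aeval (chebFor P.BtB)

namespace Assumptions

lemma evaluates_dualOracle (hP : P.Assumptions) :
    Evaluates P primalStored primalStored (dualOracle P.F) 1 0 0 := by
  refine fun s q hq =>
    ⟨_, Run.init.oracle (block q) (mem_blockwise.1 hq), mem_blockwise.2 fun i => ?_⟩
  rw [hP.block_dualOracle]
  exact Submodule.mem_sup_right (Submodule.mem_span_singleton_self _)

lemma evaluates_bigW (hP : P.Assumptions) :
    Evaluates P primalStored primalStored P.bigW.toEuclideanLin 0 1 0 := by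
  refine fun s x hx =>
    ⟨_, Run.init.comm (block x) (mem_blockwise.1 hx), mem_blockwise.2 fun i => ?_⟩
  rw [bigW, block_kronecker_one]
  refine Submodule.sum_mem _ fun j _ => ?_
  rcases eq_or_ne i j with rfl | hij
  · exact Submodule.smul_mem _ _ (Submodule.mem_sup_left (mem_blockwise.1 hx i))
  by_cases adj : P.graph.Adj i j
  · exact Submodule.smul_mem _ _
      (Submodule.mem_sup_right (Submodule.subset_span ⟨j, adj, rfl⟩))
  · rw [hP.compatible i j hij adj, zero_smul]
    exact zero_mem _

lemma evaluates_transpose_A (hP : P.Assumptions) (γ : ℝ) :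
    Evaluates P dualStored primalStored (P.A γ).transpose.toEuclideanLin 0 1 1 := by
  intro s y hy
  obtain ⟨s₁, hs₁, hBu⟩ := evaluates_bigB_transpose s _ hy.2
  obtain ⟨s₂, hs₂, hWv⟩ := hP.evaluates_bigW s₁ _ (primalStored.mono hs₁.le hy.1)
  refine ⟨s₂, hs₁.trans hs₂, ?_⟩
  rw [transpose_A_toEuclideanLin hP.posSemidef.1]
  exact add_mem (primalStored.mono hs₂.le hBu) (Submodule.smul_mem _ γ hWv)

lemma evaluates_A (hP : P.Assumptions) (γ : ℝ) :
    Evaluates P primalStored dualStored (P.A γ).toEuclideanLin 0 1 1 := by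
  intro s x hx
  obtain ⟨s₁, hs₁, hBx⟩ := evaluates_bigB s x hx
  obtain ⟨s₂, hs₂, hWx⟩ := hP.evaluates_bigW s₁ x (primalStored.mono hs₁.le hx)
  refine ⟨s₂, hs₁.trans hs₂, ?_, ?_⟩
  · rw [toLp_A_toEuclideanLin_inr]
    exact Submodule.smul_mem _ γ hWx
  · rw [toLp_A_toEuclideanLin_inl]
    exact auxStored.mono hs₂.le hBx

lemma evaluates_chebMat_W (hP : P.Assumptions) :
    Evaluates P primalStored primalStored
      (chebMat P.W ⊗ₖ (1 : Matrix (Fin d) (Fin d) ℝ)).toEuclideanLin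
      0 (chebFor P.W).natDegree 0 := by
  rw [chebMat, aeval_kronecker_one, ← bigW]
  simpa only [mul_zero, mul_one] using hP.evaluates_bigW.toEuclideanLin_aeval (chebFor P.W)

lemma evaluates_chebGram (hP : P.Assumptions) :
    Evaluates P primalStored primalStored P.chebGram.toEuclideanLin
      0 (2 * (chebFor P.W).natDegree) (2 * (chebFor P.BtB).natDegree) := by
  have evaluates_sum := evaluates_chebMat_BtB.add
    ((hP.evaluates_chebMat_W.comp hP.evaluates_chebMat_W).const_smul
      (lamMinPos (chebMat P.BtB) / lamMinPos (chebMat P.W) ^ 2))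
  convert evaluates_sum using 1
  · rw [chebGram, ← mul_one (1 : Matrix (Fin d) (Fin d) ℝ), Matrix.mul_kronecker_mul,
      Matrix.toEuclideanLin, map_add, map_smul, Matrix.toLpLin_mul (q := 2), mul_one]
    rfl
  all_goals ring

end Assumptions

end Problem

section Accel

variable {E : Type} [NormedAddCommGroup E] [InnerProductSpace ℝ E]
  {K : Memory m d p →o Submodule ℝ E} {g : E → E}

lemma Evaluates.exists_run_accel (hg : Evaluates P K K g a c b) (η β : ℝ) {y₀ : E}
    (hy₀ : y₀ ∈ K s₀) (k : ℕ) :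
    ∃ s, Run P s₀ s (k * a) (k * c) (k * b) ∧
      (accel g η β y₀ k).1 ∈ K s ∧ (accel g η β y₀ k).2 ∈ K s := by
  induction k with
  | zero => exact ⟨s₀, by simpa only [zero_mul] using Run.init, hy₀, hy₀⟩
  | succ k ih =>
    obtain ⟨s, hs, hy, hy'⟩ := ih
    have hz : extrapolation β (accel g η β y₀ k) ∈ K s :=
      add_mem hy (Submodule.smul_mem _ β (sub_mem hy hy'))
    obtain ⟨s', hs', hgz⟩ := hg s _ hz
    refine ⟨s', ?_, ?_, K.mono hs'.le hy⟩
    · simpa only [add_one_mul] using hs.trans hs'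
    · exact sub_mem (K.mono hs'.le hz) (Submodule.smul_mem _ η hgz)

lemma Evaluates.computes_accel (hg : Evaluates P K K g a c b) (η β : ℝ) {y₀ : E}
    (hy₀ : y₀ ∈ K s₀) {x : E → Vec (Fin m × Fin d)}
    (hx : Evaluates P K primalStored x a' c' b') (N : ℕ) :
    Computes P s₀ (x (accel g η β y₀ N).1) (N * a + a') (N * c + c') (N * b + b') := by
  obtain ⟨s, hs, hy, -⟩ := hg.exists_run_accel η β hy₀ N
  obtain ⟨s', hs', hxy⟩ := hx s _ hy
  exact ⟨s', hs.trans hs', mem_blockwise.1 hxy⟩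

end Accel

namespace Problem.Assumptions

lemma computes_globallyDual (hP : P.Assumptions)
    {H : Matrix (Fin m × Fin d) (Fin m × Fin d) ℝ}
    (hH : Evaluates P primalStored primalStored H.toEuclideanLin 0 c b)
    (p₀ : Vec (Fin m × Fin d)) (N : ℕ) :
    Computes P (primalMemory p p₀) (dualOracle P.F (P.globallyDual H p₀ N))
      (N + 1) (N * c) (N * b) := by
  have iteration := hH.comp hP.evaluates_dualOracle
  have computes : Computes P (primalMemory p p₀) (dualOracle P.F (P.globallyDual H p₀ N)) _ _ _ :=
    iteration.computes_accel (P.step H) (P.momentum H) (mem_primalStored_primalMemory p₀)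
      hP.evaluates_dualOracle N
  convert computes using 1 <;> ring

lemma computes_fastDual (hP : P.Assumptions) (γ : ℝ) (y₀ : Vec (DualIdx m d p)) (N : ℕ) :
    Computes P (dualMemory y₀)
      (dualOracle P.F ((P.A γ).transpose.toEuclideanLin (P.fastDual γ y₀ N)))
      (N + 1) (2 * N + 1) (2 * N + 1) := by
  have readout := hP.evaluates_dualOracle.comp (hP.evaluates_transpose_A γ)
  have iteration : Evaluates P dualStored dualStored (∇ (P.Phi γ)) 1 2 2 := by
    convert (hP.evaluates_A γ).comp readout using 1
    exact funext fun y => (hP.hasGradientAt_Phi γ y).gradient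
  have computes : Computes P (dualMemory y₀)
      (dualOracle P.F ((P.A γ).transpose.toEuclideanLin (P.fastDual γ y₀ N))) _ _ _ :=
    iteration.computes_accel (P.step (P.gram γ)) (P.momentum (P.gram γ))
      (mem_dualStored_dualMemory y₀) readout N
  convert computes using 1 <;> ring

end Problem.Assumptions

end Cost

/-! ### Complexity -/

section Complexity

lemma mul_two_mul_natCast_le {D : ℕ} {t : ℝ} (hD : (D : ℝ) ≤ 2 * t) (ht : 0 ≤ t) (N : ℕ) :
    ((N * (2 * D) : ℕ) : ℝ) ≤ 100 * (N + 1 : ℕ) * t := by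
  push_cast
  calc (N : ℝ) * (2 * D) ≤ N * (2 * (2 * t)) := by gcongr
    _ = 4 * N * t := by ring
    _ ≤ 100 * (N + 1) * t := by
      gcongr
      · norm_num
      · linarith

namespace Problem.Assumptions

variable {m d p : ℕ} {P : Problem m d p} {xs p₀ : Vec (Fin m × Fin d)} {γ ε : ℝ}

lemma exists_forall_epsSolution_globallyDual (hP : P.Assumptions)
    {H : Matrix (Fin m × Fin d) (Fin m × Fin d) ℝ} (hH : P.IsConstraintGram H)
    (hxs : P.IsSolution xs) (hp₀ : p₀ ∈ P.feasibleSubspaceᗮ) (hγ : 0 < γ) (hε : 0 < ε)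
    (hε₁ : ε < 1) :
    ∃ N : ℕ, (∀ k ≥ N, P.EpsSolution γ ε (dualOracle P.F (P.globallyDual H p₀ k))) ∧
      (N + 1 : ℝ) ≤ 5 * (√(P.L / P.μ) * √(chi H) * Real.log (P.scale γ p₀ xs / ε)) := by
  have one_le_sqrt_chi := Real.one_le_sqrt.2 (one_le_chi hH.posSemidef hH.ne_zero)
  set X := √(P.L / P.μ) * √(chi H) * Real.log (P.scale γ p₀ xs / ε)
  have one_le_X : 1 ≤ X := one_le_mul_of_one_le_of_one_le
    (one_le_mul_of_one_le_of_one_le hP.one_le_sqrt_L_div_mu one_le_sqrt_chi)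
    (hP.one_le_log_scale γ p₀ xs hε hε₁)
  refine ⟨⌈3 * X⌉₊, fun k hk => ?_, ?_⟩
  · refine hP.epsSolution_globallyDual hH hxs hp₀ hγ hε hε₁ ?_
    calc √(P.L / P.μ) * √(chi H) * (3 * Real.log (P.scale γ p₀ xs / ε)) = 3 * X := by ring
      _ ≤ k := Nat.ceil_le.1 hk
  · linarith [Nat.ceil_lt_add_one (by linarith : 0 ≤ 3 * X)]

lemma fastDual_gap_complexity (hP : P.Assumptions) (hγ : 0 < γ) (hxs : P.IsSolution xs)
    (y₀ : Vec (DualIdx m d p)) (hε : 0 < ε) (hε₁ : ε < 1) {k : ℕ}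
    (hk : 100 * √(P.L / P.μ) * √(chi (P.gram γ)) *
      Real.log (P.scale γ ((P.A γ).transpose.toEuclideanLin y₀) xs / ε) ≤ k)
    (y : Vec (DualIdx m d p)) : P.Phi γ (P.fastDual γ y₀ k) - P.Phi γ y ≤ ε := by
  have log_nonneg := zero_le_one.trans
    (hP.one_le_log_scale γ ((P.A γ).transpose.toEuclideanLin y₀) xs hε hε₁)
  refine hP.fastDual_gap_le hγ hxs y₀ hε (le_trans ?_ hk) y
  gcongr
  linarith [Real.sqrt_nonneg (P.L / P.μ)]

lemma fastDual_complexity (hP : P.Assumptions) (hxs : P.IsSolution xs)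
    (y₀ : Vec (DualIdx m d p)) (hε : 0 < ε) (hε₁ : ε < 1) :
    ∃ N a c b : ℕ,
      (∀ k ≥ N, P.EpsSolution P.gammaOpt ε (dualOracle P.F
        ((P.A P.gammaOpt).transpose.toEuclideanLin (P.fastDual P.gammaOpt y₀ k)))) ∧
      Computes P (dualMemory y₀) (dualOracle P.F
        ((P.A P.gammaOpt).transpose.toEuclideanLin (P.fastDual P.gammaOpt y₀ N))) a c b ∧
      ((max (max N a) (max c b) : ℕ) : ℝ) ≤
        100 * √(P.L / P.μ) * √(chi P.BtB + chi P.W ^ 2) * Real.log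
          (P.scale P.gammaOpt ((P.A P.gammaOpt).transpose.toEuclideanLin y₀) xs / ε) := by
  have hγ := hP.gammaOpt_pos
  obtain ⟨N, epsSolution, N_le⟩ := hP.exists_forall_epsSolution_globallyDual
    (hP.isConstraintGram_gram hγ) hxs (hP.transpose_A_mem hγ y₀) hγ hε hε₁
  refine ⟨N, N + 1, 2 * N + 1, 2 * N + 1, fun k hk => ?_, hP.computes_fastDual _ y₀ N, ?_⟩
  · rw [hP.transpose_A_fastDual]
    exact epsSolution k hk
  · rw [hP.chi_gram_gammaOpt] at N_le
    have max_eq : max (max N (N + 1)) (max (2 * N + 1) (2 * N + 1)) = 2 * N + 1 := by omega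
    rw [max_eq]
    push_cast
    linarith

lemma chebyshev_complexity (hP : P.Assumptions) (hxs : P.IsSolution xs)
    (hp₀ : p₀ ∈ LinearMap.range (P.A P.gammaOpt).transpose.toEuclideanLin)
    (hε : 0 < ε) (hε₁ : ε < 1) :
    ∃ N a c b : ℕ,
      (∀ k ≥ N, P.EpsSolution P.gammaOpt ε (dualOracle P.F (P.globallyDual P.chebGram p₀ k))) ∧
      Computes P (primalMemory p p₀) (dualOracle P.F (P.globallyDual P.chebGram p₀ N)) a c b ∧
      ((max N a : ℕ) : ℝ) ≤ 100 * √(P.L / P.μ) * Real.log (P.scale P.gammaOpt p₀ xs / ε) ∧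
      (c : ℝ) ≤ 100 * a * √(chi P.W) ∧ (b : ℝ) ≤ 100 * a * √(chi P.BtB) := by
  have hγ := hP.gammaOpt_pos
  obtain ⟨y, rfl⟩ := hp₀
  obtain ⟨N, epsSolution, N_le⟩ := hP.exists_forall_epsSolution_globallyDual
    hP.isConstraintGram_chebGram hxs (hP.transpose_A_mem hγ y) hγ hε hε₁
  refine ⟨N, N + 1, _, _, epsSolution, hP.computes_globallyDual hP.evaluates_chebGram _ N, ?_,
    mul_two_mul_natCast_le hP.isSingularPosSemidef_W.natDegree_chebFor_le (Real.sqrt_nonneg _) N,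
    mul_two_mul_natCast_le hP.isSingularPosSemidef_BtB.natDegree_chebFor_le (Real.sqrt_nonneg _) N⟩
  set p₀ := (P.A P.gammaOpt).transpose.toEuclideanLin y
  have log_nonneg := zero_le_one.trans (hP.one_le_log_scale P.gammaOpt p₀ xs hε hε₁)
  have sqrt_chi_le : √(chi P.chebGram) ≤ 6 :=
    Real.sqrt_le_iff.2 ⟨by norm_num, by linarith [hP.chi_chebGram_le]⟩
  rw [max_eq_right N.le_succ, Nat.cast_succ]
  calc (N + 1 : ℝ)
      ≤ 5 * (√(P.L / P.μ) * √(chi P.chebGram) * Real.log (P.scale P.gammaOpt p₀ xs / ε)) := N_le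
    _ ≤ 5 * (√(P.L / P.μ) * 20 * Real.log (P.scale P.gammaOpt p₀ xs / ε)) := by
      gcongr
      linarith
    _ = 100 * √(P.L / P.μ) * Real.log (P.scale P.gammaOpt p₀ xs / ε) := by ring

end Problem.Assumptions

end Complexity

end GloballyDual

end

open GloballyDual in
theorem mainTheorem3 :
    ∃ C : ℝ, 0 < C ∧ ∀ (m d p : ℕ) (P : Problem m d p), P.Assumptions →
    ∃ xs : Vec (Fin m × Fin d), P.IsSolution xs ∧
    -- the dual oracle of `F` is the unique maximizer of `⟨q, x⟩ - F x`
    (∀ q z : Vec (Fin m × Fin d),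
      IsMaxOn (fun x => ⟪q, x⟫ - P.F x) Set.univ z ↔ z = dualOracle P.F q) ∧
    -- the dual function: well defined, its gradient, smoothness and strong convexity
    (∀ γ : ℝ, 0 < γ →
      (∀ y, IsGreatest (Set.range fun x => -P.F x + ⟪y, (P.A γ).toEuclideanLin x⟫) (P.Phi γ y) ∧
        P.Phi γ y = conjugate P.F ((P.A γ).transpose.toEuclideanLin y) ∧
        HasGradientAt (P.Phi γ)
          ((P.A γ).toEuclideanLin (dualOracle P.F ((P.A γ).transpose.toEuclideanLin y))) y) ∧
      IsSmooth (lamMax (P.gram γ) / P.μ) (P.Phi γ) ∧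
      IsStronglyConvexOn ((LinearMap.ker (P.A γ).transpose.toEuclideanLin)ᗮ : Set _)
        (lamMinPos (P.gram γ) / P.L) (P.Phi γ)) ∧
    -- the fast gradient method on the dual function, and its form in the variables `Aᵀ y`
    (∀ γ : ℝ, 0 < γ → ∀ y₀ : Vec (Problem.DualIdx m d p),
      (∀ ε : ℝ, 0 < ε → ε < 1 → ∀ k : ℕ,
        C * √(P.L / P.μ) * √(chi (P.gram γ)) *
            Real.log (P.scale γ ((P.A γ).transpose.toEuclideanLin y₀) xs / ε) ≤ k →
        ∀ y, P.Phi γ (P.fastDual γ y₀ k) - P.Phi γ y ≤ ε) ∧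
      0 < P.step (P.gram γ) ∧ 0 < P.momentum (P.gram γ) ∧ P.momentum (P.gram γ) < 1 ∧
      ∀ k, (P.A γ).transpose.toEuclideanLin (P.fastDual γ y₀ k) =
        P.globallyDual (P.gram γ) ((P.A γ).transpose.toEuclideanLin y₀) k) ∧
    -- the condition number of `Aᵀ A` and its minimum over `γ`
    (∀ γ : ℝ, 0 < γ → chi (P.gram γ) =
      (lamMax P.BtB + γ ^ 2 * lamMax P.W ^ 2) /
        min (lamMinPos P.BtB) (γ ^ 2 * lamMinPos P.W ^ 2)) ∧
    0 < P.gammaOpt ∧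
    chi (P.gram P.gammaOpt) = chi P.BtB + chi P.W ^ 2 ∧
    (∀ γ : ℝ, 0 < γ → chi (P.gram P.gammaOpt) ≤ chi (P.gram γ)) ∧
    -- complexity of the fast gradient method on the dual function
    (∀ (y₀ : Vec (Problem.DualIdx m d p)) (ε : ℝ), 0 < ε → ε < 1 →
      ∃ N a c b : ℕ,
        (∀ k ≥ N, P.EpsSolution P.gammaOpt ε (dualOracle P.F
          ((P.A P.gammaOpt).transpose.toEuclideanLin (P.fastDual P.gammaOpt y₀ k)))) ∧
        Computes P (dualMemory y₀) (dualOracle P.F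
          ((P.A P.gammaOpt).transpose.toEuclideanLin (P.fastDual P.gammaOpt y₀ N))) a c b ∧
        ((max (max N a) (max c b) : ℕ) : ℝ) ≤
          C * √(P.L / P.μ) * √(chi P.BtB + chi P.W ^ 2) * Real.log
            (P.scale P.gammaOpt ((P.A P.gammaOpt).transpose.toEuclideanLin y₀) xs / ε)) ∧
    -- the Chebyshev polynomials
    (((chebFor P.W).natDegree : ℝ) ≤ C * √(chi P.W) ∧ chi (chebMat P.W) ≤ C ∧
      ((chebFor P.BtB).natDegree : ℝ) ≤ C * √(chi P.BtB) ∧ chi (chebMat P.BtB) ≤ C) ∧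
    -- complexity of the globally dual method with Chebyshev acceleration
    (0 < P.step P.chebGram ∧ 0 < P.momentum P.chebGram ∧ P.momentum P.chebGram < 1) ∧
    (∀ p₀ ∈ LinearMap.range (P.A P.gammaOpt).transpose.toEuclideanLin,
      ∀ ε : ℝ, 0 < ε → ε < 1 →
      ∃ N a c b : ℕ,
        (∀ k ≥ N, P.EpsSolution P.gammaOpt ε (dualOracle P.F (P.globallyDual P.chebGram p₀ k))) ∧
        Computes P (primalMemory p p₀)
          (dualOracle P.F (P.globallyDual P.chebGram p₀ N)) a c b ∧
        ((max N a : ℕ) : ℝ) ≤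
          C * √(P.L / P.μ) * Real.log (P.scale P.gammaOpt p₀ xs / ε) ∧
        (c : ℝ) ≤ C * a * √(chi P.W) ∧
        (b : ℝ) ≤ C * a * √(chi P.BtB)) := by
  refine ⟨100, by norm_num, fun m d p P hP => ?_⟩
  obtain ⟨xs, hxs⟩ := hP.exists_isSolution
  have hW := hP.isSingularPosSemidef_W
  have hBtB := hP.isSingularPosSemidef_BtB
  have hcheb := hP.isConstraintGram_chebGram
  refine ⟨xs, hxs, hP.isStronglyConvexOn_F.isMaxOn_iff_eq_dualOracle hP.μ_pos,
    fun γ hγ => ⟨fun y => ⟨hP.isGreatest_Phi γ y, P.Phi_eq_conjugate γ y,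
      hP.hasGradientAt_Phi γ y⟩, hP.isSmooth_Phi hγ, hP.isStronglyConvexOn_Phi hγ⟩,
    fun γ hγ y₀ => ⟨fun ε hε hε₁ k hk => hP.fastDual_gap_complexity hγ hxs y₀ hε hε₁ hk,
      hP.step_pos (hP.isConstraintGram_gram hγ), hP.momentum_pos (hP.isConstraintGram_gram hγ),
      hP.momentum_lt_one (hP.isConstraintGram_gram hγ), hP.transpose_A_fastDual γ y₀⟩,
    fun γ hγ => hP.chi_gram hγ, hP.gammaOpt_pos, hP.chi_gram_gammaOpt,
    fun γ hγ => hP.chi_gram_gammaOpt_le hγ,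
    fun y₀ ε hε hε₁ => hP.fastDual_complexity hxs y₀ hε hε₁,
    ⟨?_, hW.chi_chebMat_le.trans (by norm_num), ?_, hBtB.chi_chebMat_le.trans (by norm_num)⟩,
    ⟨hP.step_pos hcheb, hP.momentum_pos hcheb, hP.momentum_lt_one hcheb⟩,
    fun p₀ hp₀ ε hε hε₁ => hP.chebyshev_complexity hxs hp₀ hε hε₁⟩
  · exact hW.natDegree_chebFor_le.trans (by gcongr; norm_num)
  · exact hBtB.natDegree_chebFor_le.trans (by gcongr; norm_num)
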